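/- Identify $\mathbb R^n$ with its dual by the standard pairing $\langle\cdot,\cdot\rangle$. For a convex body $K\subset\mathbb R^n$ with the origin in its interior let $K^\circ=\{p:\langle p,q\rangle\le 1\ \forall q\in K\}$, and for such a body $T$ put $\|x\|_T=\max_{p\in T}\langle p,x\rangle$ (so $\|\cdot\|_{K^\circ}$ is the norm, possibly non-symmetric, with unit body $K$). The smooth piece of $\partial K$ is the set of $q\in\partial K$ at which $\|\cdot\|_{K^\circ}$ is differentiable (for a polytope: the union of the relative interiors of the facets), and there $n_K(q)=d\|q\|_{K^\circ}$. Hanner polytopes are the bodies obtained from the segment $[-1,1]\subset\mathbb R$ by iterating the operations $(K,L)\mapsto K\oplus_1L$ and $(K,L)\mapsto K\oplus_\infty L$, where for $K\subset\mathbb R^k$ and $L\subset\mathbb R^l$, the unit bodies of norms $\|\cdot\|^{(1)}$ and $\|\cdot\|^{(2)}$, the bodies $K\oplus_1L,\ K\oplus_\infty L\subset\mathbb R^{k+l}$ are the unit bodies of $\|\cdot\|^{(1)}+\|\cdot\|^{(2)}$ and $\max\{\|\cdot\|^{(1)},\|\cdot\|^{(2)}\}$, respectively. A closed classical billiard trajectory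 in $K\times T$ consists of $m\ge 2$ bounce points $q_1,\dots,q_m$ in the smooth piece of $\partial K$ and momenta $p_1,\dots,p_m$ in the smooth piece of $\partial T$, indices modulo $m$, such that for all $i$ $$p_{i+1}-p_i=-\lambda_i\,n_K(q_i),\qquad q_{i+1}-q_i=\mu_i\,n_T(p_{i+1}),\qquad \lambda_i,\mu_i>0 .$$ Its length is $\ell_T(q_1,\dots,q_m)=\sum_{i=1}^m\|q_{i+1}-q_i\|_T$, and it traces in phase space the closed curve formed by the segments from $(q_i,p_i)$ to $(q_i,p_{i+1})$ and from $(q_i,p_{i+1})$ to $(q_{i+1},p_{i+1})$, for all $i$. Let $\xi_T(K)$ be the minimum of $\ell_T(x_1,\dots,x_m)$ over all $m\ge2$ and all closed polygonal lines $(x_1,\dots,x_m)$ whose vertices do not all lie in one translate of $\operatorname{int}K$. **Corollary.** Let $H\subset\mathbb R^n$ be a Hanner polytope, let $(q,p)\in\partial(H\times H^\circ)$, and let $U$ be any neighborhood of $(q,p)$ in $\mathbb R^n\times\mathbb R^n$. Then there is a closed classical billiard trajectory in $H\times H^\circ$ whose phase-space curve meets $U$ and which has minimal length: its length equals $\xi_{H^\circ}(H)$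 (the minimum being attained), and no closed classical billiard trajectory in $H\times H^\circ$ is shorter. -/

import Mathlib

open scoped Topology

namespace Billiard

/-- The (one-sided) polar body of `K`; `V = ℝⁿ` and its dual are paired by the dot product. -/
def polarBody {n : ℕ} (K : Set (Fin n → ℝ)) : Set (Fin n → ℝ) :=
  {p | ∀ q ∈ K, dotProduct p q ≤ 1}

/-- `‖x‖_T = max_{p ∈ T} ⟨p, x⟩`, the (possibly non-symmetric) norm whose unit ball is the
polar of `T`. -/
noncomputable def finslerNorm {n : ℕ} (T : Set (Fin n → ℝ)) (x : Fin n → ℝ) : ℝ :=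
  sSup ((fun p => dotProduct p x) '' T)

/-- `K ⊕₁ L`: the unit body of `‖·‖⁽¹⁾ + ‖·‖⁽²⁾`, where `K` and `L` are the unit bodies of
the two norms. -/
def sumOne {k l : ℕ} (K : Set (Fin k → ℝ)) (L : Set (Fin l → ℝ)) : Set (Fin (k + l) → ℝ) :=
  {x | gauge K (fun i => x (Fin.castAdd l i)) + gauge L (fun j => x (Fin.natAdd k j)) ≤ 1}

/-- `K ⊕_∞ L`: the unit body of `max {‖·‖⁽¹⁾, ‖·‖⁽²⁾}`. -/
def sumInfty {k l : ℕ} (K : Set (Fin k → ℝ)) (L : Set (Fin l → ℝ)) : Set (Fin (k + l) → ℝ) :=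
  {x | max (gauge K (fun i => x (Fin.castAdd l i))) (gauge L (fun j => x (Fin.natAdd k j))) ≤ 1}

/-- Hanner polytopes: the segment `[-1, 1]` in dimension one, and everything obtained from it
by iterating the direct sums `⊕₁` and `⊕_∞`. -/
inductive IsHanner : (n : ℕ) → Set (Fin n → ℝ) → Prop
  | segment : IsHanner 1 {x | x 0 ∈ Set.Icc (-1 : ℝ) 1}
  | one {k l : ℕ} {K : Set (Fin k → ℝ)} {L : Set (Fin l → ℝ)} :
      IsHanner k K → IsHanner l L → IsHanner (k + l) (sumOne K L)
  | infty {k l : ℕ} {K : Set (Fin k → ℝ)} {L : Set (Fin l → ℝ)} :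
      IsHanner k K → IsHanner l L → IsHanner (k + l) (sumInfty K L)

/-- The smooth piece of `∂K`: the boundary points at which the norm `‖·‖_{K°}` with unit body
`K` is differentiable. For a polytope these are the relative interiors of the facets. -/
def smoothBoundary {n : ℕ} (K : Set (Fin n → ℝ)) : Set (Fin n → ℝ) :=
  {q | q ∈ frontier K ∧ DifferentiableAt ℝ (finslerNorm (polarBody K)) q}

/-- The outer normal `n_K(q) = d‖q‖_{K°}`, as a vector of partial derivatives. It is only
used at points of `smoothBoundary K`. -/
noncomputable def outerNormal {n : ℕ} (K : Set (Fin n → ℝ)) (q : Fin n → ℝ) : Fin n → ℝ :=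
  fun i => fderiv ℝ (finslerNorm (polarBody K)) q (Pi.single i 1)

/-- The length `∑ ‖q_{i+1} - q_i‖_T` of a closed polygonal line; `finRotate m` is the cyclic
successor `i ↦ i + 1` on `Fin m`. -/
noncomputable def closedLength {n m : ℕ} (T : Set (Fin n → ℝ)) (q : Fin m → Fin n → ℝ) : ℝ :=
  ∑ i, finslerNorm T (q (finRotate m i) - q i)

/-- `𝒫_m(K)`: the `m`-tuples that do not fit into any translate of the interior of `K`. -/
def nonTranslatable {n : ℕ} (K : Set (Fin n → ℝ)) (m : ℕ) : Set (Fin m → Fin n → ℝ) :=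
  {q | ¬ ∃ t : Fin n → ℝ, ∀ i, q i - t ∈ interior K}

/-- The lengths of all closed polygonal lines with at least two vertices that do not fit into a
translate of the interior of `K`. The minimum of this set is `ξ_T(K)`. -/
def candidateLengths {n : ℕ} (K T : Set (Fin n → ℝ)) : Set ℝ :=
  {s | ∃ m : ℕ, 2 ≤ m ∧ ∃ q ∈ nonTranslatable K m, closedLength T q = s}

/-- A closed classical billiard trajectory in `K × T` with bounce points `q i` and momenta
`p i`. The momentum `p (i + 1)` is the one on the way from `q i` to `q (i + 1)`. All bounce
points and momenta are in the smooth pieces of the boundaries, the velocity is a positive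
multiple of `n_T(p)`, and `p' - p = -λ n_K(q)` with `λ > 0` at each bounce. -/
structure IsClassicalTrajectory {n m : ℕ} (K T : Set (Fin n → ℝ))
    (q p : Fin m → Fin n → ℝ) : Prop where
  two_le : 2 ≤ m
  coord_mem : ∀ i, q i ∈ smoothBoundary K
  momentum_mem : ∀ i, p i ∈ smoothBoundary T
  motion : ∀ i, ∃ μ : ℝ, 0 < μ ∧
    q (finRotate m i) - q i = μ • outerNormal T (p (finRotate m i))
  reflection : ∀ i, ∃ r : ℝ, 0 < r ∧
    p (finRotate m i) - p i = -(r • outerNormal K (q i))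

/-- The closed curve in phase space traced by a trajectory: the point moves from `q i` to
`q (i + 1)` with momentum `p (i + 1)`, and during the bounce at `q i` the momentum moves along
the segment from `p i` to `p (i + 1)`. -/
def phaseCurve {n m : ℕ} (q p : Fin m → Fin n → ℝ) : Set ((Fin n → ℝ) × (Fin n → ℝ)) :=
  ⋃ i, (segment ℝ (q i, p (finRotate m i)) (q (finRotate m i), p (finRotate m i)) ∪
    segment ℝ (q i, p i) (q i, p (finRotate m i)))

end Billiard

/-! The minimal length is 4, and near every boundary phase point there passes an explicit centrally
symmetric trajectory of that length.

Lower bound. `H` is the unit ball of a symmetric norm, so a closed line shorter than 4 lies in the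
open unit ball around the midpoint of two of its points that halve its length
(`DualPair.four_le_closedLength`). The bounce points of a trajectory cannot lie in a translate of
the interior, because positive multiples of their normals sum to zero
(`IsClassicalTrajectory.nonTranslatable`).

Flags. Suppose w_0, …, w_n in H° and v_0, …, v_{n-1} in H satisfy ⟨w_j, v_i⟩ = 1 for j ≤ i and -1
for i < j. Then the v_i form a basis, w_n = -w_0, and both sequences extend by W_{i+n} = -W_i,
V_{i+n} = -V_i (`IsFlag`). For positive n-periodic weights t, s of total 1 over a period, the point
q_j = Σ t_i V_i over j ≤ i < j+n is smooth with normal W_j, and q_{j+1} = q_j - 2 t_j V_j; the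
momenta behave in the same way with s and W. This is a trajectory with 2n bounces and length 4
(`IsFlag.isClassicalTrajectory`, `IsFlag.closedLength_eq`).

Words. It remains to write a given (q, p) with q ∈ ∂H and p ∈ H° as q = Σ t_i v_i, p = Σ s_j w_j
with nonnegative weights of total 1. Because w_n = -w_0, p then lies on the segment of momenta of
the bounce at q_0 = q (`IsWord.exists_flag`); zero weights are removed by a perturbation. The
alternating word w_0 v_0 w_1 … v_{n-1} w_n is built along the recursive construction of H: words of
the two summands are shuffled, combining momenta for ⊕₁ and coordinates for ⊕_∞ (`exists_isMerge`,
`HasWords.sum`, `HasWords.max`). The case p ∈ ∂H° follows by exchanging the roles of coordinates and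
momenta. -/

open scoped Matrix

namespace Billiard

/-! ### Gauges and dual pairs of unit balls -/

/-- A nonnegative absolutely homogeneous function is the gauge of its unit sublevel set. -/
theorem gauge_sublevel {n : ℕ} {f : (Fin n → ℝ) → ℝ} (h0 : ∀ x, 0 ≤ f x)
    (hs : ∀ (c : ℝ) x, f (c • x) = |c| * f x) (x : Fin n → ℝ) :
    gauge {x | f x ≤ 1} x = f x := by
  have key : ∀ r : ℝ, 0 < r → (r⁻¹ • x ∈ {x | f x ≤ 1} ↔ f x ≤ r) := by
    intro r hr
    simp only [Set.mem_ofPred_eq, hs, abs_inv, abs_of_pos hr]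
    rw [inv_mul_le_iff₀ hr, mul_one]
  rw [gauge_def']
  apply le_antisymm
  · refine le_of_forall_pos_le_add fun ε hε => ?_
    have hpos : 0 < f x + ε := by linarith [h0 x]
    exact csInf_le ⟨0, fun r hr => le_of_lt hr.1⟩
      ⟨hpos, (key _ hpos).2 (by linarith)⟩
  · refine le_csInf ⟨f x + 1, ?_, ?_⟩ ?_
    · exact Set.mem_Ioi.2 (by linarith [h0 x])
    · exact (key _ (by linarith [h0 x])).2 (by linarith)
    · rintro r ⟨hr, hx⟩
      exact (key r hr).1 hx

/-- Two bodies that are the unit balls of norms dual to each other. -/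
structure DualPair {n : ℕ} (K K' : Set (Fin n → ℝ)) : Prop where
  mem : ∀ x, x ∈ K ↔ gauge K x ≤ 1
  mem' : ∀ p, p ∈ K' ↔ gauge K' p ≤ 1
  smul : ∀ (c : ℝ) x, gauge K (c • x) = |c| * gauge K x
  smul' : ∀ (c : ℝ) p, gauge K' (c • p) = |c| * gauge K' p
  le : ∀ p x, p ⬝ᵥ x ≤ gauge K' p * gauge K x
  attained : ∀ x, ∃ p ∈ K', p ⬝ᵥ x = gauge K x
  attained' : ∀ p, ∃ x ∈ K, p ⬝ᵥ x = gauge K' p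
  exists_unit : ∃ x, gauge K x = 1

namespace DualPair

variable {n : ℕ} {K K' : Set (Fin n → ℝ)}

theorem pairing_le (h : DualPair K K') {p x : Fin n → ℝ} (hp : p ∈ K') :
    p ⬝ᵥ x ≤ gauge K x :=
  (h.le p x).trans (mul_le_of_le_one_left (gauge_nonneg _) ((h.mem' p).1 hp))

theorem symm (h : DualPair K K') : DualPair K' K where
  mem := h.mem'
  mem' := h.mem
  smul := h.smul'
  smul' := h.smul
  le p x := by rw [dotProduct_comm, mul_comm]; exact h.le x p
  attained x := by simpa only [dotProduct_comm] using h.attained' x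
  attained' x := by simpa only [dotProduct_comm] using h.attained x
  exists_unit := by
    obtain ⟨x, hx⟩ := h.exists_unit
    obtain ⟨p, hp, hpx⟩ := h.attained x
    refine ⟨p, le_antisymm ((h.mem' p).1 hp) ?_⟩
    have := h.le p x
    rw [hpx, hx] at this
    linarith

theorem neg (h : DualPair K K') (x : Fin n → ℝ) : gauge K (-x) = gauge K x := by
  have := h.smul (-1) x
  simpa using this

theorem neg_mem (h : DualPair K K') {x : Fin n → ℝ} (hx : x ∈ K) : -x ∈ K := by
  rw [h.mem, h.neg]; exact (h.mem x).1 hx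

theorem triangle (h : DualPair K K') (x y : Fin n → ℝ) :
    gauge K (x + y) ≤ gauge K x + gauge K y := by
  obtain ⟨p, hp, hpx⟩ := h.attained (x + y)
  rw [← hpx, dotProduct_add]
  exact add_le_add (h.pairing_le hp) (h.pairing_le hp)

theorem sub_comm (h : DualPair K K') (x y : Fin n → ℝ) : gauge K (x - y) = gauge K (y - x) := by
  rw [← h.neg, neg_sub]

theorem sub_le (h : DualPair K K') (x y z : Fin n → ℝ) :
    gauge K (x - z) ≤ gauge K (x - y) + gauge K (y - z) := by
  simpa using h.triangle (x - y) (y - z)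

theorem eq_zero (h : DualPair K K') {x : Fin n → ℝ} (hx : gauge K x = 0) : x = 0 := by
  have h1 := h.le x x
  rw [hx, mul_zero] at h1
  exact dotProduct_self_eq_zero.1 (le_antisymm h1 (Finset.sum_nonneg fun i _ => mul_self_nonneg _))

theorem pos_dim (h : DualPair K K') : 0 < n := by
  rcases Nat.eq_zero_or_pos n with rfl | hn
  · obtain ⟨x, hx⟩ := h.exists_unit
    rw [Subsingleton.elim x 0, gauge_zero] at hx
    norm_num at hx
  · exact hn

theorem exists_bound (h : DualPair K K') : ∃ C, ∀ x, gauge K x ≤ C * ‖x‖ := by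
  refine ⟨∑ i, gauge K (Pi.single i 1), fun x => ?_⟩
  obtain ⟨p, hp, hpx⟩ := h.attained x
  rw [← hpx, dotProduct, Finset.sum_mul]
  refine Finset.sum_le_sum fun i _ => ?_
  have h1 : |p i| ≤ gauge K (Pi.single i 1) := by
    refine abs_le'.2 ⟨?_, ?_⟩
    · simpa using h.pairing_le (x := Pi.single i 1) hp
    · rw [← h.neg (Pi.single i 1)]
      simpa using h.pairing_le (x := -Pi.single i 1) hp
  calc p i * x i ≤ |p i| * |x i| := by rw [← abs_mul]; exact le_abs_self _
    _ ≤ _ := mul_le_mul h1 (norm_le_pi_norm x i) (abs_nonneg _) (gauge_nonneg _)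

theorem continuous_gauge (h : DualPair K K') : Continuous (gauge K) := by
  obtain ⟨C, hC⟩ := h.exists_bound
  refine (LipschitzWith.of_le_add_mul (Real.toNNReal C) fun x y => ?_).continuous
  have h1 : gauge K x ≤ gauge K y + gauge K (x - y) := by
    simpa using h.triangle y (x - y)
  refine h1.trans (add_le_add le_rfl ((hC _).trans ?_))
  rw [dist_eq_norm]
  exact mul_le_mul_of_nonneg_right (Real.le_coe_toNNReal C) (norm_nonneg _)

theorem isClosed (h : DualPair K K') : IsClosed K := by
  have : K = gauge K ⁻¹' Set.Iic 1 := by ext x; exact h.mem x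
  rw [this]
  exact isClosed_Iic.preimage h.continuous_gauge

theorem mem_interior (h : DualPair K K') (x : Fin n → ℝ) : x ∈ interior K ↔ gauge K x < 1 := by
  constructor
  · intro hx
    -- Multiples `c • x` with `c` slightly above 1 are still in `K`, which forces the norm of `x`
    -- strictly below 1.
    have hc : Filter.Tendsto (fun c : ℝ => c • x) (𝓝[>] 1) (𝓝 x) := by
      have : Continuous fun c : ℝ => c • x := by fun_prop
      simpa using (this.tendsto 1).mono_left nhdsWithin_le_nhds
    obtain ⟨c, hc1, hc2⟩ := ((hc.eventually (mem_interior_iff_mem_nhds.1 hx)).and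
      self_mem_nhdsWithin).exists
    have hc2 : 1 < c := hc2
    have h1 := (h.mem _).1 hc1
    rw [h.smul, abs_of_pos (by linarith)] at h1
    by_contra! h2
    nlinarith
  · intro hx
    refine _root_.mem_interior.2 ⟨gauge K ⁻¹' Set.Iio 1, fun y hy => (h.mem y).2 (le_of_lt hy), ?_, hx⟩
    exact isOpen_Iio.preimage h.continuous_gauge

theorem mem_frontier (h : DualPair K K') (x : Fin n → ℝ) : x ∈ frontier K ↔ gauge K x = 1 := by
  rw [frontier, h.isClosed.closure_eq, Set.mem_sdiff, h.mem_interior, h.mem, not_lt, le_antisymm_iff]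

theorem polarBody_eq (h : DualPair K K') : polarBody K = K' := by
  ext p
  constructor
  · intro hp
    obtain ⟨x, hx, hpx⟩ := h.attained' p
    rw [h.mem', ← hpx]
    exact hp x hx
  · intro hp x hx
    exact (h.pairing_le hp).trans ((h.mem x).1 hx)

theorem finslerNorm_eq (h : DualPair K K') : finslerNorm K' = gauge K := by
  funext x
  obtain ⟨p, hp, hpx⟩ := h.attained x
  refine (IsGreatest.csSup_eq ⟨⟨p, hp, hpx⟩, ?_⟩)
  rintro _ ⟨q, hq, rfl⟩
  exact h.pairing_le hq

end DualPair

/-! ### Direct sums of dual pairs -/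

theorem dotProduct_split {k l : ℕ} (p x : Fin (k + l) → ℝ) :
    p ⬝ᵥ x = (fun i => p (Fin.castAdd l i)) ⬝ᵥ (fun i => x (Fin.castAdd l i)) +
      (fun j => p (Fin.natAdd k j)) ⬝ᵥ (fun j => x (Fin.natAdd k j)) := by
  simp only [dotProduct, Fin.sum_univ_add]

theorem dotProduct_append {k l : ℕ} (a c : Fin k → ℝ) (b d : Fin l → ℝ) :
    Fin.append a b ⬝ᵥ Fin.append c d = a ⬝ᵥ c + b ⬝ᵥ d := by
  rw [dotProduct_split]; simp

theorem gauge_sumOne {k l : ℕ} {K K' : Set (Fin k → ℝ)} {L L' : Set (Fin l → ℝ)}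
    (hK : DualPair K K') (hL : DualPair L L') (x : Fin (k + l) → ℝ) :
    gauge (sumOne K L) x = gauge K (fun i => x (Fin.castAdd l i)) +
      gauge L (fun j => x (Fin.natAdd k j)) := by
  refine gauge_sublevel (f := fun x => gauge K (fun i => x (Fin.castAdd l i)) +
      gauge L (fun j => x (Fin.natAdd k j)))
    (fun x => add_nonneg (gauge_nonneg _) (gauge_nonneg _)) (fun c x => ?_) x
  have h1 := hK.smul c (fun i => x (Fin.castAdd l i))
  have h2 := hL.smul c (fun i => x (Fin.natAdd k i))
  simp only [mul_add]
  rw [← h1, ← h2]; rfl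

theorem gauge_sumInfty {k l : ℕ} {K K' : Set (Fin k → ℝ)} {L L' : Set (Fin l → ℝ)}
    (hK : DualPair K K') (hL : DualPair L L') (x : Fin (k + l) → ℝ) :
    gauge (sumInfty K L) x = max (gauge K (fun i => x (Fin.castAdd l i)))
      (gauge L (fun j => x (Fin.natAdd k j))) := by
  refine gauge_sublevel (f := fun x => max (gauge K (fun i => x (Fin.castAdd l i)))
      (gauge L (fun j => x (Fin.natAdd k j))))
    (fun x => le_max_of_le_left (gauge_nonneg _)) (fun c x => ?_) x
  have h1 := hK.smul c (fun i => x (Fin.castAdd l i))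
  have h2 := hL.smul c (fun i => x (Fin.natAdd k i))
  simp only [mul_max_of_nonneg _ _ (abs_nonneg c)]
  rw [← h1, ← h2]; rfl

theorem DualPair.sum {k l : ℕ} {K K' : Set (Fin k → ℝ)} {L L' : Set (Fin l → ℝ)}
    (hK : DualPair K K') (hL : DualPair L L') :
    DualPair (sumOne K L) (sumInfty K' L') where
  mem x := by rw [gauge_sumOne hK hL]; rfl
  mem' x := by rw [gauge_sumInfty hK.symm hL.symm]; rfl
  smul c x := by
    have h1 := hK.smul c (fun i => x (Fin.castAdd l i))
    have h2 := hL.smul c (fun i => x (Fin.natAdd k i))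
    rw [gauge_sumOne hK hL, gauge_sumOne hK hL, mul_add, ← h1, ← h2]; rfl
  smul' c x := by
    have h1 := hK.smul' c (fun i => x (Fin.castAdd l i))
    have h2 := hL.smul' c (fun i => x (Fin.natAdd k i))
    rw [gauge_sumInfty hK.symm hL.symm, gauge_sumInfty hK.symm hL.symm,
      mul_max_of_nonneg _ _ (abs_nonneg c), ← h1, ← h2]; rfl
  le p x := by
    rw [gauge_sumOne hK hL, gauge_sumInfty hK.symm hL.symm, dotProduct_split, mul_add]
    refine add_le_add ((hK.le _ _).trans ?_) ((hL.le _ _).trans ?_)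
    · exact mul_le_mul_of_nonneg_right (le_max_left _ _) (gauge_nonneg _)
    · exact mul_le_mul_of_nonneg_right (le_max_right _ _) (gauge_nonneg _)
  attained x := by
    obtain ⟨p, hp, hpx⟩ := hK.attained (fun i => x (Fin.castAdd l i))
    obtain ⟨r, hr, hrx⟩ := hL.attained (fun i => x (Fin.natAdd k i))
    refine ⟨Fin.append p r, ?_, ?_⟩
    · simpa [sumInfty] using And.intro ((hK.mem' p).1 hp) ((hL.mem' r).1 hr)
    · rw [dotProduct_split, gauge_sumOne hK hL, ← hpx, ← hrx]; simp
  attained' p := by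
    obtain ⟨x, hx, hpx⟩ := hK.attained' (fun i => p (Fin.castAdd l i))
    obtain ⟨y, hy, hpy⟩ := hL.attained' (fun i => p (Fin.natAdd k i))
    rw [gauge_sumInfty hK.symm hL.symm]
    -- The maximum of the two norms is attained by testing only on the summand with the larger norm.
    rcases le_total (gauge K' (fun i => p (Fin.castAdd l i)))
      (gauge L' (fun i => p (Fin.natAdd k i))) with h | h
    · refine ⟨Fin.append 0 y, ?_, ?_⟩
      · have h0 : gauge K (fun _ : Fin k => (0 : ℝ)) = 0 := gauge_zero
        simpa [sumOne, h0] using (hL.mem y).1 hy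
      · rw [max_eq_right h, dotProduct_split, ← hpy]; simp
    · refine ⟨Fin.append x 0, ?_, ?_⟩
      · have h0 : gauge L (fun _ : Fin l => (0 : ℝ)) = 0 := gauge_zero
        simpa [sumOne, h0] using (hK.mem x).1 hx
      · rw [max_eq_left h, dotProduct_split, ← hpx]; simp
  exists_unit := by
    obtain ⟨x, hx⟩ := hK.exists_unit
    refine ⟨Fin.append x 0, ?_⟩
    have h0 : gauge L (fun _ : Fin l => (0 : ℝ)) = 0 := gauge_zero
    rw [gauge_sumOne hK hL]
    simp [h0, hx]

theorem gauge_segment (x : Fin 1 → ℝ) : gauge {x : Fin 1 → ℝ | x 0 ∈ Set.Icc (-1 : ℝ) 1} x = |x 0| := by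
  have : {x : Fin 1 → ℝ | x 0 ∈ Set.Icc (-1 : ℝ) 1} = {x | |x 0| ≤ 1} := by
    ext x; simp [abs_le]
  rw [this]
  exact gauge_sublevel (f := fun x : Fin 1 → ℝ => |x 0|) (fun x => abs_nonneg _)
    (fun c x => by simp [abs_mul]) x

theorem dualPair_segment : DualPair {x : Fin 1 → ℝ | x 0 ∈ Set.Icc (-1 : ℝ) 1}
    {x : Fin 1 → ℝ | x 0 ∈ Set.Icc (-1 : ℝ) 1} := by
  have hatt : ∀ x : Fin 1 → ℝ, ∃ p : Fin 1 → ℝ, p 0 ∈ Set.Icc (-1 : ℝ) 1 ∧ p 0 * x 0 = |x 0| := by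
    intro x
    rcases abs_cases (x 0) with h | h
    · exact ⟨fun _ => 1, by norm_num, by simp [h.1]⟩
    · exact ⟨fun _ => -1, by norm_num, by simp [h.1]⟩
  refine ⟨fun x => ?_, fun x => ?_, fun c x => ?_, fun c x => ?_, fun p x => ?_, fun x => ?_,
    fun x => ?_, fun _ => 1, ?_⟩
  · rw [gauge_segment]; simp [abs_le]
  · rw [gauge_segment]; simp [abs_le]
  · rw [gauge_segment, gauge_segment, Pi.smul_apply, smul_eq_mul, abs_mul]
  · rw [gauge_segment, gauge_segment, Pi.smul_apply, smul_eq_mul, abs_mul]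
  · rw [gauge_segment, gauge_segment, ← abs_mul, dotProduct, Fin.sum_univ_one]
    exact le_abs_self _
  · rw [gauge_segment]
    simpa [dotProduct] using hatt x
  · rw [gauge_segment]
    simpa [dotProduct, mul_comm] using hatt x
  · rw [gauge_segment, abs_one]

/-! ### Alternating words and their shuffles -/

/-- A weighted vector of one of two kinds: `true` for momenta (normals), `false` for coordinates
(velocities). -/
structure Letter (n : ℕ) where
  kind : Bool
  vec : Fin n → ℝ
  wt : ℝ

/-- The kinds alternate, beginning and ending with `κ`. -/
inductive Alternates {n : ℕ} (κ : Bool) : List (Letter n) → Prop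
  | single (x : Letter n) : x.kind = κ → Alternates κ [x]
  | cons (x y : Letter n) (l : List (Letter n)) :
      x.kind = κ → y.kind = !κ → Alternates κ l → Alternates κ (x :: y :: l)

/-- The sign rule for a letter `a` that precedes `b` in a word. -/
def Compat {n : ℕ} (a b : Letter n) : Prop :=
  a.kind ≠ b.kind → a.vec ⬝ᵥ b.vec = if a.kind then 1 else -1

/-- The total weight of the letters of kind `κ`. -/
def weightSum {n : ℕ} (κ : Bool) (l : List (Letter n)) : ℝ :=
  (l.map fun a => if a.kind = κ then a.wt else 0).sum

/-- The weighted sum of the letters of kind `κ`. -/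
def vecSum {n : ℕ} (κ : Bool) (l : List (Letter n)) : Fin n → ℝ :=
  (l.map fun a => if a.kind = κ then a.wt • a.vec else 0).sum

@[simp] theorem weightSum_nil {n : ℕ} (κ : Bool) : weightSum κ ([] : List (Letter n)) = 0 := rfl

@[simp] theorem vecSum_nil {n : ℕ} (κ : Bool) : vecSum κ ([] : List (Letter n)) = 0 := rfl

@[simp] theorem weightSum_cons {n : ℕ} (κ : Bool) (a : Letter n) (l : List (Letter n)) :
    weightSum κ (a :: l) = (if a.kind = κ then a.wt else 0) + weightSum κ l := by
  simp [weightSum]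

@[simp] theorem vecSum_cons {n : ℕ} (κ : Bool) (a : Letter n) (l : List (Letter n)) :
    vecSum κ (a :: l) = (if a.kind = κ then a.wt • a.vec else 0) + vecSum κ l := by
  simp [vecSum]

@[simp] theorem weightSum_append {n : ℕ} (κ : Bool) (l m : List (Letter n)) :
    weightSum κ (l ++ m) = weightSum κ l + weightSum κ m := by
  simp [weightSum]

@[simp] theorem vecSum_append {n : ℕ} (κ : Bool) (l m : List (Letter n)) :
    vecSum κ (l ++ m) = vecSum κ l + vecSum κ m := by
  simp [vecSum]

theorem weightSum_nonneg {n : ℕ} (κ : Bool) {l : List (Letter n)} (h : ∀ a ∈ l, 0 ≤ a.wt) :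
    0 ≤ weightSum κ l := by
  refine List.sum_nonneg fun x hx => ?_
  obtain ⟨a, ha, rfl⟩ := List.mem_map.1 hx
  split_ifs
  exacts [h a ha, le_rfl]

theorem append_add_append {k l : ℕ} (a c : Fin k → ℝ) (b d : Fin l → ℝ) :
    Fin.append a b + Fin.append c d = Fin.append (a + c) (b + d) := by
  funext i
  refine Fin.addCases (fun i => ?_) (fun i => ?_) i <;> simp

theorem smul_append {k l : ℕ} (r : ℝ) (a : Fin k → ℝ) (b : Fin l → ℝ) :
    r • Fin.append a b = Fin.append (r • a) (r • b) := by
  funext i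
  refine Fin.addCases (fun i => ?_) (fun i => ?_) i <;> simp

theorem append_zero_zero {k l : ℕ} : Fin.append (0 : Fin k → ℝ) (0 : Fin l → ℝ) = 0 := by
  funext i
  refine Fin.addCases (fun i => ?_) (fun i => ?_) i <;> simp

/-- `m` is a shuffle of `l₁` and `l₂` in which the letters of kind `κ` are combined. -/
structure IsMerge {k l : ℕ} (κ : Bool) (l₁ : List (Letter k)) (l₂ : List (Letter l))
    (m : List (Letter (k + l))) : Prop where
  alternates : Alternates κ m
  length : m.length + 1 = l₁.length + l₂.length
  compat : m.Pairwise Compat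
  nonneg : ∀ a ∈ m, 0 ≤ a.wt
  combined : ∀ a ∈ m, a.kind = κ → ∃ b ∈ l₁, ∃ c ∈ l₂, b.kind = κ ∧ c.kind = κ ∧
    a.vec = Fin.append b.vec c.vec
  separate : ∀ a ∈ m, a.kind = !κ → (∃ b ∈ l₁, b.kind = !κ ∧ a.vec = Fin.append b.vec 0) ∨
    (∃ c ∈ l₂, c.kind = !κ ∧ a.vec = Fin.append 0 c.vec)
  weight : weightSum κ m = weightSum κ l₁
  weight_not : weightSum (!κ) m = weightSum (!κ) l₁ + weightSum (!κ) l₂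
  vec : vecSum κ m = Fin.append (vecSum κ l₁) (vecSum κ l₂)
  vec_not : vecSum (!κ) m = Fin.append (vecSum (!κ) l₁) (vecSum (!κ) l₂)

/-- One step of the shuffle: `x` and `z` run side by side until the weight of `x` is used up, `z`
keeps the remainder, and then `y` is emitted. The sign rule survives because a padded letter pairs
only with its own component, whose order is unchanged. -/
theorem IsMerge.cons_left {k l : ℕ} {κ : Bool} {x y : Letter k} {z : Letter l}
    {l₁ : List (Letter k)} {l₂ : List (Letter l)} {m : List (Letter (k + l))}
    (hx : x.kind = κ) (hy : y.kind = !κ) (hz : z.kind = κ)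
    (hx0 : 0 ≤ x.wt) (hy0 : 0 ≤ y.wt)
    (h₁ : (x :: y :: l₁).Pairwise Compat) (h₂ : (z :: l₂).Pairwise Compat)
    (hm : IsMerge κ l₁ (⟨z.kind, z.vec, z.wt - x.wt⟩ :: l₂) m) :
    IsMerge κ (x :: y :: l₁) (z :: l₂)
      (⟨κ, Fin.append x.vec z.vec, x.wt⟩ :: ⟨!κ, Fin.append y.vec 0, y.wt⟩ :: m) := by
  simp only [List.pairwise_cons, List.mem_cons, forall_eq_or_imp] at h₁ h₂
  obtain ⟨⟨hxy, hxl⟩, hyl, -⟩ := h₁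
  obtain ⟨hzl, -⟩ := h₂
  have hsep := hm.separate
  have hcom := hm.combined
  have hκ : κ ≠ !κ := by cases κ <;> simp
  refine ⟨.cons _ _ _ rfl rfl hm.alternates, ?_, ?_, ?_, ?_, ?_, ?_, ?_, ?_, ?_⟩
  · have := hm.length
    simp only [List.length_cons] at this ⊢
    omega
  · simp only [List.pairwise_cons, List.mem_cons, forall_eq_or_imp]
    refine ⟨⟨fun _ => ?_, fun a ha hk => ?_⟩, fun a ha hk => ?_, hm.compat⟩
    · rw [dotProduct_append, dotProduct_zero, add_zero, hxy (by rw [hx, hy]; exact hκ), hx]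
    · have hk' : a.kind = !κ := Bool.eq_not_of_ne (Ne.symm hk)
      rcases hsep a ha hk' with ⟨b, hb, hbk, hv⟩ | ⟨c, hc, hck, hv⟩
      · simp only [hv, dotProduct_append, dotProduct_zero, add_zero]
        rw [hxl b hb (by rw [hx, hbk]; exact hκ), hx]
      · simp only [hv, dotProduct_append, dotProduct_zero, zero_add]
        rcases List.mem_cons.1 hc with rfl | hc
        · exact absurd (hz.symm.trans hck) hκ
        · rw [hzl c hc (by rw [hz, hck]; exact hκ), hz]
    · have hk' : a.kind = κ := by
        have := Bool.eq_not_of_ne (Ne.symm hk); simpa using this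
      obtain ⟨b, hb, c, hc, hbk, hck, hv⟩ := hcom a ha hk'
      simp only [hv, dotProduct_append, zero_dotProduct, add_zero]
      rw [hyl b hb (by rw [hy, hbk]; exact hκ.symm), hy]
  · simp only [List.mem_cons, forall_eq_or_imp]
    exact ⟨hx0, hy0, hm.nonneg⟩
  · simp only [List.mem_cons, forall_eq_or_imp]
    refine ⟨fun _ => ⟨x, .inl rfl, z, .inl rfl, hx, hz, rfl⟩, fun h => absurd h.symm hκ, ?_⟩
    intro a ha hk
    obtain ⟨b, hb, c, hc, hbk, hck, hv⟩ := hcom a ha hk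
    rcases List.mem_cons.1 hc with rfl | hc
    · exact ⟨b, .inr (.inr hb), z, .inl rfl, hbk, hz, hv⟩
    · exact ⟨b, .inr (.inr hb), c, .inr hc, hbk, hck, hv⟩
  · simp only [List.mem_cons, forall_eq_or_imp]
    refine ⟨fun h => absurd h hκ, fun _ => .inl ⟨y, .inr (.inl rfl), hy, rfl⟩, ?_⟩
    intro a ha hk
    rcases hsep a ha hk with ⟨b, hb, hbk, hv⟩ | ⟨c, hc, hck, hv⟩
    · exact .inl ⟨b, .inr (.inr hb), hbk, hv⟩
    · rcases List.mem_cons.1 hc with rfl | hc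
      · exact absurd (hz.symm.trans hck) hκ
      · exact .inr ⟨c, .inr hc, hck, hv⟩
  · simp [hx, hy, hm.weight]
  · have := hm.weight_not
    simp only [weightSum_cons, hz] at this
    simp [hx, hy, hz, this]
    ring
  · have := hm.vec
    simp only [vecSum_cons, hz] at this
    simp only [vecSum_cons, hx, hy, hz, this, hκ.symm, if_true, if_false, zero_add,
      smul_append, append_add_append]
    congr 1
    rw [sub_smul]; abel
  · have := hm.vec_not
    simp only [vecSum_cons, hz, hκ, if_false, zero_add] at this
    simp only [vecSum_cons, hx, hy, hz, this, hκ, if_true, if_false, zero_add,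
      smul_append, append_add_append, smul_zero]

theorem IsMerge.cons_right {k l : ℕ} {κ : Bool} {z : Letter k} {x y : Letter l}
    {l₁ : List (Letter k)} {l₂ : List (Letter l)} {m : List (Letter (k + l))}
    (hx : x.kind = κ) (hy : y.kind = !κ) (hz : z.kind = κ)
    (hx0 : 0 ≤ x.wt) (hy0 : 0 ≤ y.wt)
    (h₁ : (z :: l₁).Pairwise Compat) (h₂ : (x :: y :: l₂).Pairwise Compat)
    (hm : IsMerge κ (⟨z.kind, z.vec, z.wt - x.wt⟩ :: l₁) l₂ m) :
    IsMerge κ (z :: l₁) (x :: y :: l₂)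
      (⟨κ, Fin.append z.vec x.vec, x.wt⟩ :: ⟨!κ, Fin.append 0 y.vec, y.wt⟩ :: m) := by
  simp only [List.pairwise_cons, List.mem_cons, forall_eq_or_imp] at h₁ h₂
  obtain ⟨⟨hxy, hxl⟩, hyl, -⟩ := h₂
  obtain ⟨hzl, -⟩ := h₁
  have hsep := hm.separate
  have hcom := hm.combined
  have hκ : κ ≠ !κ := by cases κ <;> simp
  refine ⟨.cons _ _ _ rfl rfl hm.alternates, ?_, ?_, ?_, ?_, ?_, ?_, ?_, ?_, ?_⟩
  · have := hm.length
    simp only [List.length_cons] at this ⊢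
    omega
  · simp only [List.pairwise_cons, List.mem_cons, forall_eq_or_imp]
    refine ⟨⟨fun _ => ?_, fun a ha hk => ?_⟩, fun a ha hk => ?_, hm.compat⟩
    · rw [dotProduct_append, dotProduct_zero, zero_add, hxy (by rw [hx, hy]; exact hκ), hx]
    · have hk' : a.kind = !κ := Bool.eq_not_of_ne (Ne.symm hk)
      rcases hsep a ha hk' with ⟨b, hb, hbk, hv⟩ | ⟨c, hc, hck, hv⟩
      · simp only [hv, dotProduct_append, dotProduct_zero, add_zero]
        rcases List.mem_cons.1 hb with rfl | hb
        · exact absurd (hz.symm.trans hbk) hκ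
        · rw [hzl b hb (by rw [hz, hbk]; exact hκ), hz]
      · simp only [hv, dotProduct_append, dotProduct_zero, zero_add]
        rw [hxl c hc (by rw [hx, hck]; exact hκ), hx]
    · have hk' : a.kind = κ := by
        have := Bool.eq_not_of_ne (Ne.symm hk); simpa using this
      obtain ⟨b, hb, c, hc, hbk, hck, hv⟩ := hcom a ha hk'
      simp only [hv, dotProduct_append, zero_dotProduct, zero_add]
      rw [hyl c hc (by rw [hy, hck]; exact hκ.symm), hy]
  · simp only [List.mem_cons, forall_eq_or_imp]
    exact ⟨hx0, hy0, hm.nonneg⟩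
  · simp only [List.mem_cons, forall_eq_or_imp]
    refine ⟨fun _ => ⟨z, .inl rfl, x, .inl rfl, hz, hx, rfl⟩, fun h => absurd h.symm hκ, ?_⟩
    intro a ha hk
    obtain ⟨b, hb, c, hc, hbk, hck, hv⟩ := hcom a ha hk
    rcases List.mem_cons.1 hb with rfl | hb
    · exact ⟨z, .inl rfl, c, .inr (.inr hc), hz, hck, hv⟩
    · exact ⟨b, .inr hb, c, .inr (.inr hc), hbk, hck, hv⟩
  · simp only [List.mem_cons, forall_eq_or_imp]
    refine ⟨fun h => absurd h hκ, fun _ => .inr ⟨y, .inr (.inl rfl), hy, rfl⟩, ?_⟩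
    intro a ha hk
    rcases hsep a ha hk with ⟨b, hb, hbk, hv⟩ | ⟨c, hc, hck, hv⟩
    · rcases List.mem_cons.1 hb with rfl | hb
      · exact absurd (hz.symm.trans hbk) hκ
      · exact .inl ⟨b, .inr hb, hbk, hv⟩
    · exact .inr ⟨c, .inr (.inr hc), hck, hv⟩
  · have := hm.weight
    simp only [weightSum_cons, hz] at this
    simp [hz, this]
    ring
  · have := hm.weight_not
    simp only [weightSum_cons, hz] at this
    simp [hx, hy, hz, this]
    ring
  · have := hm.vec
    simp only [vecSum_cons, hz] at this
    simp only [vecSum_cons, hx, hy, hz, this, hκ.symm, if_true, if_false, zero_add,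
      smul_append, append_add_append]
    congr 1
    rw [sub_smul]; abel
  · have := hm.vec_not
    simp only [vecSum_cons, hz, hκ, if_false, zero_add] at this
    simp only [vecSum_cons, hx, hy, hz, this, hκ, if_true, if_false, zero_add,
      smul_append, append_add_append, smul_zero]

/-- The letters of kind `κ` subdivide two intervals of equal length, and the common refinement is
read from left to right, the other letters sitting at the division points. The induction on the
total length consumes the lighter of the two leading `κ`-letters. -/
theorem exists_isMerge {k l : ℕ} {κ : Bool} (N : ℕ) : ∀ {l₁ : List (Letter k)}
    {l₂ : List (Letter l)}, l₁.length + l₂.length ≤ N → Alternates κ l₁ → Alternates κ l₂ →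
    (∀ a ∈ l₁, 0 ≤ a.wt) → (∀ a ∈ l₂, 0 ≤ a.wt) → l₁.Pairwise Compat → l₂.Pairwise Compat →
    weightSum κ l₁ = weightSum κ l₂ → ∃ m, IsMerge κ l₁ l₂ m := by
  have hκ : (!κ) ≠ κ := by cases κ <;> simp
  have hrw : ∀ {n : ℕ} {z : Letter n} {t : List (Letter n)} (c : ℝ), Alternates κ (z :: t) →
      Alternates κ (⟨z.kind, z.vec, c⟩ :: t) := by
    intro n z t c h
    cases h with
    | single _ h => exact .single _ h
    | cons _ y l h1 h2 h3 => exact .cons _ _ _ h1 h2 h3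
  have hpw : ∀ {n : ℕ} {z : Letter n} {t : List (Letter n)} (c : ℝ), (z :: t).Pairwise Compat →
      (⟨z.kind, z.vec, c⟩ :: t : List (Letter n)).Pairwise Compat := by
    intro n z t c h
    rw [List.pairwise_cons] at h ⊢
    exact h
  induction N with
  | zero =>
    intro l₁ l₂ hN h₁
    cases h₁ <;> simp at hN
  | succ N ih =>
    intro l₁ l₂ hN h₁ h₂ n₁ n₂ c₁ c₂ hw
    have left : ∀ {x y : Letter k} {z : Letter l} {t₁ : List (Letter k)} {t₂ : List (Letter l)},
        l₁ = x :: y :: t₁ → l₂ = z :: t₂ → x.kind = κ → y.kind = (!κ) → z.kind = κ →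
        Alternates κ t₁ → x.wt ≤ z.wt → ∃ m, IsMerge κ l₁ l₂ m := by
      rintro x y z t₁ t₂ rfl rfl hx hy hz ht hle
      simp only [List.mem_cons, forall_eq_or_imp] at n₁ n₂
      obtain ⟨m, hm⟩ := ih (l₁ := t₁) (l₂ := ⟨z.kind, z.vec, z.wt - x.wt⟩ :: t₂)
        (by simp only [List.length_cons] at hN ⊢; omega) ht (hrw _ h₂) n₁.2.2
        (by simp only [List.mem_cons, forall_eq_or_imp]; exact ⟨sub_nonneg.2 hle, n₂.2⟩)
        (List.pairwise_cons.1 (List.pairwise_cons.1 c₁).2).2 (hpw _ c₂)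
        (by simp only [weightSum_cons, hx, hy, hz, if_true, hκ, if_false] at hw ⊢; linarith)
      exact ⟨_, hm.cons_left hx hy hz n₁.1 n₁.2.1 c₁ c₂⟩
    have right : ∀ {z : Letter k} {x y : Letter l} {t₁ : List (Letter k)} {t₂ : List (Letter l)},
        l₁ = z :: t₁ → l₂ = x :: y :: t₂ → x.kind = κ → y.kind = (!κ) → z.kind = κ →
        Alternates κ t₂ → x.wt ≤ z.wt → ∃ m, IsMerge κ l₁ l₂ m := by
      rintro z x y t₁ t₂ rfl rfl hx hy hz ht hle
      simp only [List.mem_cons, forall_eq_or_imp] at n₁ n₂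
      obtain ⟨m, hm⟩ := ih (l₁ := ⟨z.kind, z.vec, z.wt - x.wt⟩ :: t₁) (l₂ := t₂)
        (by simp only [List.length_cons] at hN ⊢; omega) (hrw _ h₁) ht
        (by simp only [List.mem_cons, forall_eq_or_imp]; exact ⟨sub_nonneg.2 hle, n₁.2⟩) n₂.2.2
        (hpw _ c₁) (List.pairwise_cons.1 (List.pairwise_cons.1 c₂).2).2
        (by simp only [weightSum_cons, hx, hy, hz, if_true, hκ, if_false] at hw ⊢; linarith)
      exact ⟨_, hm.cons_right hx hy hz n₂.1 n₂.2.1 c₁ c₂⟩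
    cases h₁ with
    | single x hx =>
      cases h₂ with
      | single z hz =>
        simp only [weightSum_cons, hx, hz, if_true, weightSum_nil, add_zero] at hw
        refine ⟨[⟨κ, Fin.append x.vec z.vec, x.wt⟩], .single _ rfl, rfl,
          List.pairwise_singleton _ _, ?_, ?_, ?_, ?_, ?_, ?_, ?_⟩
        · simpa using n₁
        · simp [hx, hz]
        · simp [hκ.symm]
        · simp [hx]
        · simp [hx, hz]
        · simp only [vecSum_cons, hx, hz, if_true, vecSum_nil, add_zero, smul_append, hw]
        · simp [vecSum_cons, hx, hz, append_zero_zero]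
      | cons z w t₂ hz hw' ht₂ =>
        -- The single letter left in the first word carries all the remaining `κ`-weight, so it is
        -- at least as heavy as the first letter of the other word.
        refine right rfl rfl hz hw' hx ht₂ ?_
        have := weightSum_nonneg κ (l := t₂) fun a ha => n₂ a (by simp [ha])
        simp only [weightSum_cons, hx, hz, hw', hκ, if_true, if_false, weightSum_nil] at hw
        linarith
    | cons x y t₁ hx hy ht₁ =>
      cases h₂ with
      | single z hz =>
        refine left rfl rfl hx hy hz ht₁ ?_
        have := weightSum_nonneg κ (l := t₁) fun a ha => n₁ a (by simp [ha])
        simp only [weightSum_cons, hx, hz, hy, hκ, if_true, if_false, weightSum_nil] at hw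
        linarith
      | cons z w t₂ hz hw' ht₂ =>
        rcases le_total x.wt z.wt with h | h
        · exact left rfl rfl hx hy hz ht₁ h
        · exact right rfl rfl hz hw' hx ht₂ h

/-! ### Words representing a phase point -/

/-- A word with coordinates in `K` and momenta in `K'`, of total weight `σ` for the momenta and
`τ` for the coordinates, that represents `p` and `q` as weighted sums of its letters. -/
structure IsWord {n : ℕ} (κ : Bool) (K K' : Set (Fin n → ℝ)) (l : List (Letter n)) (N : ℕ)
    (σ τ : ℝ) (p q : Fin n → ℝ) : Prop where
  alternates : Alternates κ l
  length : l.length = N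
  compat : l.Pairwise Compat
  nonneg : ∀ a ∈ l, 0 ≤ a.wt
  mem_true : ∀ a ∈ l, a.kind = true → a.vec ∈ K'
  mem_false : ∀ a ∈ l, a.kind = false → a.vec ∈ K
  weight_true : weightSum true l = σ
  weight_false : weightSum false l = τ
  vec_true : vecSum true l = p
  vec_false : vecSum false l = q

/-- Multiplies the weights of the letters of kind `κ` by `r`. -/
def rescale {n : ℕ} (κ : Bool) (r : ℝ) (a : Letter n) : Letter n :=
  ⟨a.kind, a.vec, if a.kind = κ then r * a.wt else a.wt⟩

/-- Exchanges the kinds of the letters and changes the sign of those of kind `true`. -/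
def swapKind {n : ℕ} (a : Letter n) : Letter n :=
  ⟨!a.kind, if a.kind then -a.vec else a.vec, a.wt⟩

theorem alternates_map {n : ℕ} {κ κ' : Bool} {l : List (Letter n)} {f : Letter n → Letter n}
    (h : Alternates κ l) (hf : ∀ a, a.kind = κ → (f a).kind = κ')
    (hf' : ∀ a, a.kind = (!κ) → (f a).kind = !κ') : Alternates κ' (l.map f) := by
  induction h with
  | single x hx => exact .single _ (hf x hx)
  | cons x y l hx hy _ ih => exact .cons _ _ _ (hf x hx) (hf' y hy) ih

theorem weightSum_rescale {n : ℕ} (κ : Bool) (r : ℝ) (l : List (Letter n)) :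
    weightSum κ (l.map (rescale κ r)) = r * weightSum κ l := by
  induction l with
  | nil => simp
  | cons a l ih =>
    rw [List.map_cons, weightSum_cons, weightSum_cons, ih, mul_add]
    by_cases h : a.kind = κ <;> simp [rescale, h]

theorem weightSum_rescale_of_ne {n : ℕ} {κ κ' : Bool} (hκ : κ' ≠ κ) (r : ℝ)
    (l : List (Letter n)) : weightSum κ' (l.map (rescale κ r)) = weightSum κ' l := by
  induction l with
  | nil => simp
  | cons a l ih =>
    rw [List.map_cons, weightSum_cons, weightSum_cons, ih]
    by_cases h : a.kind = κ' <;> simp [rescale, h, hκ]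

theorem vecSum_rescale {n : ℕ} (κ : Bool) (r : ℝ) (l : List (Letter n)) :
    vecSum κ (l.map (rescale κ r)) = r • vecSum κ l := by
  induction l with
  | nil => simp
  | cons a l ih =>
    rw [List.map_cons, vecSum_cons, vecSum_cons, ih, smul_add]
    by_cases h : a.kind = κ <;> simp [rescale, h, mul_smul]

theorem vecSum_rescale_of_ne {n : ℕ} {κ κ' : Bool} (hκ : κ' ≠ κ) (r : ℝ)
    (l : List (Letter n)) : vecSum κ' (l.map (rescale κ r)) = vecSum κ' l := by
  induction l with
  | nil => simp
  | cons a l ih =>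
    rw [List.map_cons, vecSum_cons, vecSum_cons, ih]
    by_cases h : a.kind = κ' <;> simp [rescale, h, hκ]

theorem weightSum_swapKind {n : ℕ} (κ : Bool) (l : List (Letter n)) :
    weightSum κ (l.map swapKind) = weightSum (!κ) l := by
  induction l with
  | nil => simp
  | cons a l ih =>
    rw [List.map_cons, weightSum_cons, weightSum_cons, ih]
    cases κ <;> cases h : a.kind <;> simp [swapKind, h]

theorem vecSum_true_swapKind {n : ℕ} (l : List (Letter n)) :
    vecSum true (l.map swapKind) = vecSum false l := by
  induction l with
  | nil => simp
  | cons a l ih =>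
    rw [List.map_cons, vecSum_cons, vecSum_cons, ih]
    cases h : a.kind <;> simp [swapKind, h]

theorem vecSum_false_swapKind {n : ℕ} (l : List (Letter n)) :
    vecSum false (l.map swapKind) = -vecSum true l := by
  induction l with
  | nil => simp
  | cons a l ih =>
    rw [List.map_cons, vecSum_cons, vecSum_cons, ih, neg_add]
    cases h : a.kind <;> simp [swapKind, h]

namespace IsWord

variable {n : ℕ} {κ : Bool} {K K' : Set (Fin n → ℝ)} {l : List (Letter n)} {N : ℕ} {σ τ : ℝ}
  {p q : Fin n → ℝ}

theorem rescale_false (h : IsWord κ K K' l N σ τ p q) {r : ℝ} (hr : 0 ≤ r) :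
    IsWord κ K K' (l.map (rescale false r)) N σ (r * τ) p (r • q) where
  alternates := alternates_map h.alternates (fun _ h => h) (fun _ h => h)
  length := by simpa using h.length
  compat := List.pairwise_map.2 h.compat
  nonneg := by
    simp only [List.mem_map, forall_exists_index, and_imp, forall_apply_eq_imp_iff₂]
    intro a ha
    have := h.nonneg a ha
    simp only [rescale]
    split_ifs <;> positivity
  mem_true := by simpa [rescale] using h.mem_true
  mem_false := by simpa [rescale] using h.mem_false
  weight_true := by rw [weightSum_rescale_of_ne (by simp), h.weight_true]
  weight_false := by rw [weightSum_rescale, h.weight_false]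
  vec_true := by rw [vecSum_rescale_of_ne (by simp), h.vec_true]
  vec_false := by rw [vecSum_rescale, h.vec_false]

theorem rescale_true (h : IsWord κ K K' l N σ τ p q) {r : ℝ} (hr : 0 ≤ r) :
    IsWord κ K K' (l.map (rescale true r)) N (r * σ) τ (r • p) q where
  alternates := alternates_map h.alternates (fun _ h => h) (fun _ h => h)
  length := by simpa using h.length
  compat := List.pairwise_map.2 h.compat
  nonneg := by
    simp only [List.mem_map, forall_exists_index, and_imp, forall_apply_eq_imp_iff₂]
    intro a ha
    have := h.nonneg a ha
    simp only [rescale]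
    split_ifs <;> positivity
  mem_true := by simpa [rescale] using h.mem_true
  mem_false := by simpa [rescale] using h.mem_false
  weight_true := by rw [weightSum_rescale, h.weight_true]
  weight_false := by rw [weightSum_rescale_of_ne (by simp), h.weight_false]
  vec_true := by rw [vecSum_rescale, h.vec_true]
  vec_false := by rw [vecSum_rescale_of_ne (by simp), h.vec_false]

/-- Exchanging the kinds alone would reverse the sign rule; negating one of the two kinds restores
it. Hence `p` becomes `-p`. -/
theorem swap (hK : DualPair K K') (h : IsWord κ K K' l N σ τ p q) :
    IsWord (!κ) K' K (l.map swapKind) N τ σ q (-p) where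
  alternates := alternates_map h.alternates (fun _ h => by simp [swapKind, h])
    (fun _ h => by simp [swapKind, h])
  length := by simpa using h.length
  compat := by
    refine List.pairwise_map.2 (h.compat.imp fun {a b} hab hk => ?_)
    have hab := hab fun e => hk (by simp [swapKind, e])
    revert hab hk
    cases ha : a.kind <;> cases hb : b.kind
    · simp [swapKind, ha, hb]
    · simpa [swapKind, ha, hb] using fun h => by simp [h]
    · simp [swapKind, ha, hb]
    · simp [swapKind, ha, hb]
  nonneg := by simpa [swapKind] using h.nonneg
  mem_true := by
    simp only [List.mem_map, forall_exists_index, and_imp, forall_apply_eq_imp_iff₂]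
    intro a ha hk
    have hk : a.kind = false := by simpa [swapKind] using hk
    simpa [swapKind, hk] using h.mem_false a ha hk
  mem_false := by
    simp only [List.mem_map, forall_exists_index, and_imp, forall_apply_eq_imp_iff₂]
    intro a ha hk
    have hk : a.kind = true := by simpa [swapKind] using hk
    simpa [swapKind, hk] using hK.symm.neg_mem (h.mem_true a ha hk)
  weight_true := by rw [weightSum_swapKind]; exact h.weight_false
  weight_false := by rw [weightSum_swapKind]; exact h.weight_true
  vec_true := by rw [vecSum_true_swapKind, h.vec_false]
  vec_false := by rw [vecSum_false_swapKind, h.vec_true]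

end IsWord

/-- Removing the two outer letters makes a word begin and end with the opposite kind, so that it can
be merged along that kind; `Alternates.sandwich` puts such letters back. -/
theorem Alternates.strip {n : ℕ} {κ : Bool} {l : List (Letter n)} (h : Alternates κ l) :
    l.length = 1 ∨ ∃ a m b, l = a :: (m ++ [b]) ∧ a.kind = κ ∧ b.kind = κ ∧
      Alternates (!κ) m := by
  induction h with
  | single x hx => exact .inl rfl
  | cons x y l hx hy hl ih =>
    right
    rcases ih with h1 | ⟨a, m, b, rfl, ha, hb, hm⟩
    · obtain ⟨z, rfl⟩ := List.length_eq_one_iff.1 h1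
      refine ⟨x, [y], z, rfl, hx, ?_, .single _ hy⟩
      cases hl with
      | single _ hz => exact hz
    · exact ⟨x, y :: a :: m, b, rfl, hx, hb, .cons _ _ _ hy (by simpa using ha) hm⟩

theorem Alternates.sandwich {n : ℕ} {κ : Bool} {m : List (Letter n)} (h : Alternates (!κ) m)
    {a b : Letter n} (ha : a.kind = κ) (hb : b.kind = κ) : Alternates κ (a :: (m ++ [b])) := by
  generalize hκ : (!κ) = κ' at h
  induction h generalizing a with
  | single x hx => exact .cons _ _ _ ha (hx.trans hκ.symm) (.single _ hb)
  | cons x y l hx hy hl ih =>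
    exact .cons _ _ _ ha (hx.trans hκ.symm) (ih (by rw [hy, ← hκ]; simp))

/-! ### Words for Hanner polytopes -/

/-- Every boundary coordinate `q` and every momentum `p` are represented by a common word of
length `2 n + 1` that begins and ends with a momentum. -/
def HasWords {n : ℕ} (K K' : Set (Fin n → ℝ)) : Prop :=
  ∀ q p, gauge K q = 1 → gauge K' p ≤ 1 →
    ∃ l, IsWord true K K' l (2 * n + 1) 1 1 p q

theorem hasWords_segment : HasWords {x : Fin 1 → ℝ | x 0 ∈ Set.Icc (-1 : ℝ) 1}
    {x : Fin 1 → ℝ | x 0 ∈ Set.Icc (-1 : ℝ) 1} := by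
  intro q p hq hp
  rw [gauge_segment] at hq hp
  have hqq : q 0 * q 0 = 1 := by rw [← abs_mul_abs_self, hq, one_mul]
  have h1 := abs_le.1 hp
  have h2 := abs_le.1 hq.le
  have h3 : |p 0 * q 0| ≤ 1 := by rw [abs_mul, hq, mul_one]; exact hp
  have h4 := abs_le.1 h3
  -- Since `q 0` is 1 or -1, `p` is the convex combination of `q` and `-q` with weights (1 ± ⟨p,
  -- q⟩)/2.
  refine ⟨[⟨true, q, (1 + p 0 * q 0) / 2⟩, ⟨false, q, 1⟩, ⟨true, -q, (1 - p 0 * q 0) / 2⟩],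
    .cons _ _ _ rfl rfl (.single _ rfl), rfl, ?_, ?_, ?_, ?_, ?_, ?_, ?_, ?_⟩
  · simp [Compat, dotProduct, hqq]
  · simp only [List.mem_cons, forall_eq_or_imp, List.not_mem_nil, false_implies, implies_true,
      and_true]
    exact ⟨by linarith, by norm_num, by linarith⟩
  · simp only [List.mem_cons, forall_eq_or_imp, List.not_mem_nil, false_implies, implies_true,
      and_true]
    exact ⟨fun _ => h2, by simp, fun _ => ⟨by simpa using h2.2, by simpa using neg_le.1 h2.1⟩⟩
  · simpa using h2
  · simp; ring
  · simp
  · funext i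
    fin_cases i
    simp only [vecSum_cons, if_true, vecSum_nil, Pi.add_apply, Pi.smul_apply, smul_eq_mul,
      Bool.false_eq_true, if_false, Pi.zero_apply, Pi.neg_apply, Fin.zero_eta]
    linear_combination p 0 * hqq
  · simp

/-- A vector is a nonnegative multiple of a unit vector. -/
theorem DualPair.exists_direction {n : ℕ} {K K' : Set (Fin n → ℝ)} (h : DualPair K K')
    (x : Fin n → ℝ) : ∃ u, gauge K u = 1 ∧ gauge K x • u = x := by
  by_cases h0 : gauge K x = 0
  · obtain ⟨u, hu⟩ := h.exists_unit
    exact ⟨u, hu, by rw [h.eq_zero h0, gauge_zero, zero_smul]⟩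
  · refine ⟨(gauge K x)⁻¹ • x, ?_, ?_⟩
    · rw [h.smul, abs_inv, abs_of_nonneg (gauge_nonneg x), inv_mul_cancel₀ h0]
    · rw [smul_smul, mul_inv_cancel₀ h0, one_smul]

/-- A vector of norm at most `r` is an `r`-multiple of a vector in the unit ball. -/
theorem DualPair.exists_smul_eq {n : ℕ} {K K' : Set (Fin n → ℝ)} (h : DualPair K K')
    {x : Fin n → ℝ} {r : ℝ} (hx : gauge K x ≤ r) : ∃ u, gauge K u ≤ 1 ∧ r • u = x := by
  rcases (gauge_nonneg (s := K) x |>.trans hx).eq_or_lt with h0 | h0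
  · refine ⟨0, by simp, ?_⟩
    have h1 := h.eq_zero (le_antisymm (h0.symm ▸ hx) (gauge_nonneg x))
    rw [smul_zero, h1]
  · refine ⟨r⁻¹ • x, ?_, ?_⟩
    · rw [h.smul, abs_inv, abs_of_pos h0]
      exact inv_mul_le_one_of_le₀ hx h0.le
    · rw [smul_smul, mul_inv_cancel₀ h0.ne', one_smul]

theorem append_castAdd_natAdd {k l : ℕ} (x : Fin (k + l) → ℝ) :
    Fin.append (fun i => x (Fin.castAdd l i)) (fun j => x (Fin.natAdd k j)) = x := by
  funext i
  refine Fin.addCases (fun i => ?_) (fun i => ?_) i <;> simp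

section Sum

variable {k l : ℕ} {K K' : Set (Fin k → ℝ)} {L L' : Set (Fin l → ℝ)}

theorem append_mem_sumOne_left (hK : DualPair K K') {x : Fin k → ℝ} (hx : x ∈ K) :
    Fin.append x (0 : Fin l → ℝ) ∈ sumOne K L := by
  have h0 : gauge L (fun _ : Fin l => (0 : ℝ)) = 0 := gauge_zero
  simpa [sumOne, h0] using (hK.mem x).1 hx

theorem append_mem_sumOne_right (hL : DualPair L L') {x : Fin l → ℝ} (hx : x ∈ L) :
    Fin.append (0 : Fin k → ℝ) x ∈ sumOne K L := by
  have h0 : gauge K (fun _ : Fin k => (0 : ℝ)) = 0 := gauge_zero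
  simpa [sumOne, h0] using (hL.mem x).1 hx

theorem append_mem_sumInfty (hK : DualPair K K') (hL : DualPair L L') {x : Fin k → ℝ}
    {y : Fin l → ℝ} (hx : x ∈ K) (hy : y ∈ L) : Fin.append x y ∈ sumInfty K L := by
  simpa [sumInfty] using And.intro ((hK.mem x).1 hx) ((hL.mem y).1 hy)

/-- The coordinate weights of the two words are scaled to the norms of the components of `q`, which
add up to 1. The momentum weights both have total 1, so the words can be merged along the momenta.
-/
theorem HasWords.sum (hK : DualPair K K') (hL : DualPair L L') (wK : HasWords K K')
    (wL : HasWords L L') : HasWords (sumOne K L) (sumInfty K' L') := by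
  intro q p hq hp
  rw [gauge_sumOne hK hL] at hq
  rw [gauge_sumInfty hK.symm hL.symm, max_le_iff] at hp
  obtain ⟨u, hu, huq⟩ := hK.exists_direction (fun i => q (Fin.castAdd l i))
  obtain ⟨v, hv, hvq⟩ := hL.exists_direction (fun i => q (Fin.natAdd k i))
  obtain ⟨l₁, h₁⟩ := wK u _ hu hp.1
  obtain ⟨l₂, h₂⟩ := wL v _ hv hp.2
  have h₁ := h₁.rescale_false (gauge_nonneg (s := K) (fun i => q (Fin.castAdd l i)))
  have h₂ := h₂.rescale_false (gauge_nonneg (s := L) (fun i => q (Fin.natAdd k i)))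
  rw [huq] at h₁
  rw [hvq] at h₂
  obtain ⟨m, hm⟩ := exists_isMerge _ le_rfl h₁.alternates h₂.alternates h₁.nonneg h₂.nonneg
    h₁.compat h₂.compat (h₁.weight_true.trans h₂.weight_true.symm)
  refine ⟨m, hm.alternates, ?_, hm.compat, hm.nonneg, ?_, ?_, ?_, ?_, ?_, ?_⟩
  · have := hm.length
    rw [h₁.length, h₂.length] at this
    omega
  · intro a ha hk
    obtain ⟨b, hb, c, hc, hbk, hck, hv⟩ := hm.combined a ha hk
    rw [hv]
    exact append_mem_sumInfty hK.symm hL.symm (h₁.mem_true b hb hbk) (h₂.mem_true c hc hck)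
  · intro a ha hk
    rcases hm.separate a ha hk with ⟨b, hb, hbk, hv⟩ | ⟨b, hb, hbk, hv⟩ <;> rw [hv]
    · exact append_mem_sumOne_left hK (h₁.mem_false b hb hbk)
    · exact append_mem_sumOne_right hL (h₂.mem_false b hb hbk)
  · rw [hm.weight, h₁.weight_true]
  · have := hm.weight_not
    rw [Bool.not_true, h₁.weight_false, h₂.weight_false, mul_one, mul_one, hq] at this
    exact this
  · rw [hm.vec, h₁.vec_true, h₂.vec_true, append_castAdd_natAdd]
  · have := hm.vec_not
    rw [Bool.not_true, h₁.vec_false, h₂.vec_false, append_castAdd_natAdd] at this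
    exact this

/-- The outer momenta of `l₁` are set aside, so that both words begin and end with coordinates and
can be merged along these; the outer momenta, padded by zero, are then put back. The length comes
out as (2k+1) - 2 + (2l+1) - 1 + 2. -/
theorem IsWord.maxLeft (hK : DualPair K K') (hL : DualPair L L') {l₁ : List (Letter k)}
    {l₂ : List (Letter l)} {σ₁ σ₂ : ℝ} {p₁ q₁ : Fin k → ℝ} {p₂ q₂ : Fin l → ℝ}
    (h₁ : IsWord true K K' l₁ (2 * k + 1) σ₁ 1 p₁ q₁)
    (h₂ : IsWord false L L' l₂ (2 * l + 1) σ₂ 1 p₂ q₂) :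
    ∃ m, IsWord true (sumInfty K L) (sumOne K' L') m (2 * (k + l) + 1) (σ₁ + σ₂) 1
      (Fin.append p₁ p₂) (Fin.append q₁ q₂) := by
  rcases h₁.alternates.strip with h | ⟨a, m, b, rfl, ha, hb, hm⟩
  · have := hK.pos_dim
    rw [h₁.length] at h
    omega
  replace hm : Alternates false m := hm
  have hc := h₁.compat
  have hn := h₁.nonneg
  have ht := h₁.mem_true
  have hf := h₁.mem_false
  have hlen := h₁.length
  have e₁ := h₁.weight_true
  have e₂ := h₁.weight_false
  have e₃ := h₁.vec_true
  have e₄ := h₁.vec_false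
  simp only [weightSum_cons, weightSum_append, vecSum_cons, vecSum_append, ha, hb, if_true,
    weightSum_nil, vecSum_nil, Bool.true_eq_false, if_false, zero_add, add_zero] at e₁ e₂ e₃ e₄
  simp only [List.pairwise_cons, List.pairwise_append, List.mem_append, List.mem_singleton] at hc
  simp only [List.mem_cons, List.mem_append, List.not_mem_nil, or_false] at hn ht hf
  obtain ⟨hac, hmc, -, hbc⟩ := hc
  obtain ⟨m', hm'⟩ := exists_isMerge _ le_rfl hm h₂.alternates (fun x hx => hn x (by simp [hx]))
    h₂.nonneg hmc h₂.compat (e₂.trans h₂.weight_false.symm)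
  have f₁ := hm'.weight_not
  have f₂ := hm'.weight
  have f₃ := hm'.vec_not
  have f₄ := hm'.vec
  simp only [Bool.not_false] at f₁ f₂ f₃ f₄
  rw [h₂.weight_true] at f₁
  rw [e₂] at f₂
  rw [h₂.vec_true] at f₃
  rw [h₂.vec_false, e₄] at f₄
  refine ⟨⟨true, Fin.append a.vec 0, a.wt⟩ :: (m' ++ [⟨true, Fin.append b.vec 0, b.wt⟩]),
    hm'.alternates.sandwich (κ := true) rfl rfl, ?_, ?_, ?_, ?_, ?_, ?_, ?_, ?_, ?_⟩
  · have := hm'.length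
    rw [h₂.length] at this
    simp only [List.length_cons, List.length_append, List.length_nil] at hlen ⊢
    omega
  · simp only [List.pairwise_cons, List.pairwise_append, List.mem_append, List.mem_singleton]
    refine ⟨?_, hm'.compat, ⟨by simp, .nil⟩, ?_⟩
    · rintro x (hx | rfl) hk
      · have hk' : x.kind = false := by simpa using Bool.eq_not_of_ne (Ne.symm hk)
        obtain ⟨y, hy, z, hz, hyk, hzk, hv⟩ := hm'.combined x hx hk'
        simp only [hv, dotProduct_append, zero_dotProduct, add_zero]
        rw [hac y (.inl hy) (by rw [ha, hyk]; simp), ha]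
        rfl
      · exact absurd rfl hk
    · rintro x hx _ rfl hk
      have hk' : x.kind = false := by simpa using hk
      obtain ⟨y, hy, z, hz, hyk, hzk, hv⟩ := hm'.combined x hx hk'
      simp only [hv, dotProduct_append, dotProduct_zero, add_zero]
      rw [hbc y hy b rfl (by rw [hb, hyk]; simp), hyk, hk']
  · simp only [List.mem_cons, List.mem_append, List.not_mem_nil, or_false]
    rintro x (rfl | hx | rfl)
    exacts [hn a (.inl rfl), hm'.nonneg x hx, hn b (.inr (.inr rfl))]
  · simp only [List.mem_cons, List.mem_append, List.not_mem_nil, or_false]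
    rintro x (rfl | hx | rfl) hk
    · exact append_mem_sumOne_left hK.symm (ht a (.inl rfl) ha)
    · rcases hm'.separate x hx hk with ⟨y, hy, hyk, hv⟩ | ⟨y, hy, hyk, hv⟩ <;> rw [hv]
      · exact append_mem_sumOne_left hK.symm (ht y (.inr (.inl hy)) hyk)
      · exact append_mem_sumOne_right hL.symm (h₂.mem_true y hy hyk)
    · exact append_mem_sumOne_left hK.symm (ht b (.inr (.inr rfl)) hb)
  · simp only [List.mem_cons, List.mem_append, List.not_mem_nil, or_false]
    rintro x (rfl | hx | rfl) hk
    · exact absurd hk (by simp)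
    · obtain ⟨y, hy, z, hz, hyk, hzk, hv⟩ := hm'.combined x hx hk
      rw [hv]
      exact append_mem_sumInfty hK hL (hf y (.inr (.inl hy)) hyk) (h₂.mem_false z hz hzk)
    · exact absurd hk (by simp)
  · simp only [weightSum_cons, weightSum_append, if_true, weightSum_nil, f₁, ← e₁]
    ring
  · simp [f₂]
  · simp only [vecSum_cons, vecSum_append, if_true, vecSum_nil, f₃, ← e₃, smul_append,
      append_add_append, smul_zero, zero_add, add_zero]
  · simp [f₄]

/-- The mirror image of `IsWord.maxLeft`, with the outer momenta coming from the second summand. -/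
theorem IsWord.maxRight (hK : DualPair K K') (hL : DualPair L L') {l₁ : List (Letter k)}
    {l₂ : List (Letter l)} {σ₁ σ₂ : ℝ} {p₁ q₁ : Fin k → ℝ} {p₂ q₂ : Fin l → ℝ}
    (h₁ : IsWord false K K' l₁ (2 * k + 1) σ₁ 1 p₁ q₁)
    (h₂ : IsWord true L L' l₂ (2 * l + 1) σ₂ 1 p₂ q₂) :
    ∃ m, IsWord true (sumInfty K L) (sumOne K' L') m (2 * (k + l) + 1) (σ₁ + σ₂) 1
      (Fin.append p₁ p₂) (Fin.append q₁ q₂) := by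
  rcases h₂.alternates.strip with h | ⟨a, m, b, rfl, ha, hb, hm⟩
  · have := hL.pos_dim
    rw [h₂.length] at h
    omega
  replace hm : Alternates false m := hm
  have hc := h₂.compat
  have hn := h₂.nonneg
  have ht := h₂.mem_true
  have hf := h₂.mem_false
  have hlen := h₂.length
  have e₁ := h₂.weight_true
  have e₂ := h₂.weight_false
  have e₃ := h₂.vec_true
  have e₄ := h₂.vec_false
  simp only [weightSum_cons, weightSum_append, vecSum_cons, vecSum_append, ha, hb, if_true,
    weightSum_nil, vecSum_nil, Bool.true_eq_false, if_false, zero_add, add_zero] at e₁ e₂ e₃ e₄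
  simp only [List.pairwise_cons, List.pairwise_append, List.mem_append, List.mem_singleton] at hc
  simp only [List.mem_cons, List.mem_append, List.not_mem_nil, or_false] at hn ht hf
  obtain ⟨hac, hmc, -, hbc⟩ := hc
  obtain ⟨m', hm'⟩ := exists_isMerge _ le_rfl h₁.alternates hm h₁.nonneg
    (fun x hx => hn x (by simp [hx])) h₁.compat hmc (h₁.weight_false.trans e₂.symm)
  have f₁ := hm'.weight_not
  have f₂ := hm'.weight
  have f₃ := hm'.vec_not
  have f₄ := hm'.vec
  simp only [Bool.not_false] at f₁ f₂ f₃ f₄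
  rw [h₁.weight_true] at f₁
  rw [h₁.weight_false] at f₂
  rw [h₁.vec_true] at f₃
  rw [h₁.vec_false, e₄] at f₄
  refine ⟨⟨true, Fin.append 0 a.vec, a.wt⟩ :: (m' ++ [⟨true, Fin.append 0 b.vec, b.wt⟩]),
    hm'.alternates.sandwich (κ := true) rfl rfl, ?_, ?_, ?_, ?_, ?_, ?_, ?_, ?_, ?_⟩
  · have := hm'.length
    rw [h₁.length] at this
    simp only [List.length_cons, List.length_append, List.length_nil] at hlen ⊢
    omega
  · simp only [List.pairwise_cons, List.pairwise_append, List.mem_append, List.mem_singleton]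
    refine ⟨?_, hm'.compat, ⟨by simp, .nil⟩, ?_⟩
    · rintro x (hx | rfl) hk
      · have hk' : x.kind = false := by simpa using Bool.eq_not_of_ne (Ne.symm hk)
        obtain ⟨y, hy, z, hz, hyk, hzk, hv⟩ := hm'.combined x hx hk'
        simp only [hv, dotProduct_append, zero_dotProduct, zero_add]
        rw [hac z (.inl hz) (by rw [ha, hzk]; simp), ha]
        rfl
      · exact absurd rfl hk
    · rintro x hx _ rfl hk
      have hk' : x.kind = false := by simpa using hk
      obtain ⟨y, hy, z, hz, hyk, hzk, hv⟩ := hm'.combined x hx hk'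
      simp only [hv, dotProduct_append, dotProduct_zero, zero_add]
      rw [hbc z hz b rfl (by rw [hb, hzk]; simp), hzk, hk']
  · simp only [List.mem_cons, List.mem_append, List.not_mem_nil, or_false]
    rintro x (rfl | hx | rfl)
    exacts [hn a (.inl rfl), hm'.nonneg x hx, hn b (.inr (.inr rfl))]
  · simp only [List.mem_cons, List.mem_append, List.not_mem_nil, or_false]
    rintro x (rfl | hx | rfl) hk
    · exact append_mem_sumOne_right hL.symm (ht a (.inl rfl) ha)
    · rcases hm'.separate x hx hk with ⟨y, hy, hyk, hv⟩ | ⟨y, hy, hyk, hv⟩ <;> rw [hv]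
      · exact append_mem_sumOne_left hK.symm (h₁.mem_true y hy hyk)
      · exact append_mem_sumOne_right hL.symm (ht y (.inr (.inl hy)) hyk)
    · exact append_mem_sumOne_right hL.symm (ht b (.inr (.inr rfl)) hb)
  · simp only [List.mem_cons, List.mem_append, List.not_mem_nil, or_false]
    rintro x (rfl | hx | rfl) hk
    · exact absurd hk (by simp)
    · obtain ⟨y, hy, z, hz, hyk, hzk, hv⟩ := hm'.combined x hx hk
      rw [hv]
      exact append_mem_sumInfty hK hL (h₁.mem_false y hy hyk) (hf z (.inr (.inl hz)) hzk)
    · exact absurd hk (by simp)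
  · simp only [weightSum_cons, weightSum_append, if_true, weightSum_nil, f₁, ← e₁]
    ring
  · simp [f₂]
  · simp only [vecSum_cons, vecSum_append, if_true, vecSum_nil, f₃, ← e₃, smul_append,
      append_add_append, smul_zero, zero_add, add_zero]
  · simp [f₄]

/-- The summand in which `q` has norm 1 contributes a word that begins with a momentum. In the other
one `q` may be interior, so the word comes from the dual body, with the direction of the momentum as
boundary point, and is swapped back. -/
theorem HasWords.max (hK : DualPair K K') (hL : DualPair L L') (wK : HasWords K K')
    (wL : HasWords L L') (wK' : HasWords K' K) (wL' : HasWords L' L) :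
    HasWords (sumInfty K L) (sumOne K' L') := by
  intro q p hq hp
  rw [gauge_sumInfty hK hL] at hq
  rw [gauge_sumOne hK.symm hL.symm] at hp
  have hq' : Max.max _ _ ≤ (1 : ℝ) := hq.le
  rw [max_le_iff] at hq'
  rw [← append_castAdd_natAdd p, ← append_castAdd_natAdd q]
  rcases max_choice (gauge K (fun i => q (Fin.castAdd l i)))
    (gauge L (fun j => q (Fin.natAdd k j))) with h | h <;> rw [h] at hq
  -- The first summand absorbs the slack when `p` is interior: its momentum weight is 1 minus the
  -- norm of the second component, so the total is exactly 1.
  · have hp1 : gauge K' (fun i => p (Fin.castAdd l i)) ≤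
      1 - gauge L' (fun j => p (Fin.natAdd k j)) := by linarith
    obtain ⟨u, hu, hup⟩ := hK.symm.exists_smul_eq hp1
    obtain ⟨v, hv, hvp⟩ := hL.symm.exists_direction (fun j => p (Fin.natAdd k j))
    obtain ⟨l₁, h₁⟩ := wK _ u hq hu
    obtain ⟨l₂, h₂⟩ := wL' v (-fun j => q (Fin.natAdd k j)) hv (by rw [hL.neg]; exact hq'.2)
    have h₁ := h₁.rescale_true ((gauge_nonneg _).trans hp1)
    have h₂ := (h₂.swap hL.symm).rescale_true
      (gauge_nonneg (s := L') (fun j => p (Fin.natAdd k j)))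
    rw [hup] at h₁
    rw [hvp, neg_neg] at h₂
    have := h₁.maxLeft hK hL h₂
    simpa using this
  · have hp1 : gauge L' (fun j => p (Fin.natAdd k j)) ≤
      1 - gauge K' (fun i => p (Fin.castAdd l i)) := by linarith
    obtain ⟨u, hu, hup⟩ := hL.symm.exists_smul_eq hp1
    obtain ⟨v, hv, hvp⟩ := hK.symm.exists_direction (fun i => p (Fin.castAdd l i))
    obtain ⟨l₂, h₂⟩ := wL _ u hq hu
    obtain ⟨l₁, h₁⟩ := wK' v (-fun i => q (Fin.castAdd l i)) hv (by rw [hK.neg]; exact hq'.1)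
    have h₂ := h₂.rescale_true ((gauge_nonneg _).trans hp1)
    have h₁ := (h₁.swap hK.symm).rescale_true
      (gauge_nonneg (s := K') (fun i => p (Fin.castAdd l i)))
    rw [hup] at h₂
    rw [hvp, neg_neg] at h₁
    have := h₁.maxRight hK hL h₂
    simpa using this

end Sum

/-- Words are carried for both orders of the pair because `HasWords.max` also uses words of the dual
bodies. -/
theorem IsHanner.exists_dual {n : ℕ} {H : Set (Fin n → ℝ)} (hH : IsHanner n H) :
    ∃ H', DualPair H H' ∧ HasWords H H' ∧ HasWords H' H := by
  induction hH with
  | segment => exact ⟨_, dualPair_segment, hasWords_segment, hasWords_segment⟩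
  | one _ _ ihK ihL =>
    obtain ⟨K', hK, wK, wK'⟩ := ihK
    obtain ⟨L', hL, wL, wL'⟩ := ihL
    exact ⟨sumInfty K' L', hK.sum hL, wK.sum hK hL wL, wK'.max hK.symm hL.symm wL' wK wL⟩
  | infty _ _ ihK ihL =>
    obtain ⟨K', hK, wK, wK'⟩ := ihK
    obtain ⟨L', hL, wL, wL'⟩ := ihL
    exact ⟨sumOne K' L', (hK.symm.sum hL.symm).symm, wK.max hK hL wL wK' wL',
      wK'.sum hK.symm hL.symm wL'⟩

/-! ### The lower bound 4 -/

/-- The value of a periodic sequence at the cyclic successor. -/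
theorem apply_finRotate {α : Type*} {m : ℕ} {f : ℕ → α} (hf : ∀ i, f (i + m) = f i) (i : Fin m) :
    f (finRotate m i : ℕ) = f (i + 1) := by
  obtain ⟨m, rfl⟩ : ∃ m', m = m' + 1 := ⟨m - 1, by have := i.pos; omega⟩
  rw [finRotate_apply, Fin.val_add_one]
  split_ifs with h
  · rw [h, Fin.val_last, ← hf 0, zero_add]
  · rfl

/-- A closed polygonal line that is shorter than `4` fits into a translate of the open unit
ball. -/
theorem DualPair.four_le_closedLength {n m : ℕ} {K K' : Set (Fin n → ℝ)} (h : DualPair K K')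
    (hm : 0 < m) {q : Fin m → Fin n → ℝ} (hq : q ∈ nonTranslatable K m) :
    4 ≤ closedLength K' q := by
  by_contra! hlt
  apply hq
  set x : ℕ → Fin n → ℝ := fun i => q ⟨i % m, Nat.mod_lt _ hm⟩ with hx
  have hxm : ∀ i, x (i + m) = x i := fun i => by simp [hx]
  have hxq : ∀ i : Fin m, x i = q i := fun i => by
    simp only [hx, Nat.mod_eq_of_lt i.2]
  set d : ℕ → ℝ := fun i => gauge K (x (i + 1) - x i) with hd
  set D : ℕ → ℝ := fun j => ∑ i ∈ Finset.range j, d i with hD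
  have hDs : ∀ j, D (j + 1) = D j + d j := fun j => Finset.sum_range_succ _ _
  have hd0 : ∀ i, 0 ≤ d i := fun i => gauge_nonneg _
  have hL : closedLength K' q = D m := by
    rw [closedLength, show D m = ∑ i ∈ Finset.range m, d i from rfl, ← Fin.sum_univ_eq_sum_range]
    refine Finset.sum_congr rfl fun i _ => ?_
    rw [h.finslerNorm_eq, hd, ← hxq i, ← hxq, apply_finRotate hxm]
  have hdist : ∀ i j, i ≤ j → gauge K (x j - x i) ≤ D j - D i := by
    intro i j hij
    induction j, hij using Nat.le_induction with
    | base => simp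
    | succ j hij ih =>
      have := h.sub_le (x (j + 1)) (x j) (x i)
      rw [hDs]
      have e : d j = gauge K (x (j + 1) - x j) := rfl
      linarith
  have hD0 : D 0 = 0 := by simp [hD]
  have hDm : 0 ≤ D m := Finset.sum_nonneg fun i _ => hd0 i
  -- `k` is the edge on which half of the length is reached; `b` below is the point of this edge at
  -- exactly half the length.
  have hex : ∃ k, D m / 2 ≤ D (k + 1) := ⟨m - 1, by
    rw [Nat.sub_add_cancel hm]; linarith⟩
  classical
  set k := Nat.find hex with hk
  have hk1 : D m / 2 ≤ D (k + 1) := Nat.find_spec hex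
  have hkm : k < m := by
    have : k ≤ m - 1 := Nat.find_min' hex (by rw [Nat.sub_add_cancel hm]; linarith)
    omega
  have hk0 : D k ≤ D m / 2 := by
    rcases Nat.eq_zero_or_pos k with h0 | h0
    · rw [h0, hD0]; linarith
    · have := Nat.find_min hex (m := k - 1) (by omega)
      rw [Nat.sub_add_cancel h0] at this
      linarith
  obtain ⟨θ, hθ0, hθ1, hθ⟩ : ∃ θ : ℝ, 0 ≤ θ ∧ θ ≤ 1 ∧ D k + θ * d k = D m / 2 := by
    rcases (hd0 k).eq_or_lt with h0 | h0
    · refine ⟨0, le_rfl, zero_le_one, ?_⟩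
      have := hDs k
      linarith
    · refine ⟨(D m / 2 - D k) / d k, div_nonneg (by linarith) h0.le, ?_, ?_⟩
      · rw [div_le_one h0]
        have := hDs k
        linarith
      · rw [div_mul_cancel₀ _ h0.ne']; ring
  set b := x k + θ • (x (k + 1) - x k) with hb
  have hb1 : gauge K (b - x k) = θ * d k := by
    rw [hb, add_sub_cancel_left, h.smul, abs_of_nonneg hθ0]
  have hb2 : gauge K (x (k + 1) - b) = (1 - θ) * d k := by
    have : x (k + 1) - b = (1 - θ) • (x (k + 1) - x k) := by
      rw [hb, sub_smul, one_smul]; abel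
    rw [this, h.smul, abs_of_nonneg (by linarith)]
  have hdk := hDs k
  refine ⟨(1 / 2 : ℝ) • (x 0 + b), fun i => ?_⟩
  rw [h.mem_interior, ← hxq]
  -- The points `x 0` and `b` cut the line into two arcs of equal length, and `x i` lies on one of
  -- them.
  have hsum : gauge K (x i - x 0) + gauge K (x i - b) ≤ D m / 2 := by
    rcases Nat.lt_or_ge k i with hi | hi
    · have h1 := hdist (k + 1) i hi
      have h2 := hdist i m i.2.le
      have h3 := h.sub_le (x i) (x (k + 1)) b
      have h4 : x m = x 0 := by simpa using hxm 0
      rw [h4, h.sub_comm] at h2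
      linarith
    · have h1 := hdist 0 i (Nat.zero_le _)
      have h2 := hdist i k hi
      have h3 := h.sub_le b (x k) (x i)
      rw [h.sub_comm b (x i)] at h3
      linarith
  have hmid : x i - (1 / 2 : ℝ) • (x 0 + b) = (1 / 2 : ℝ) • ((x i - x 0) + (x i - b)) := by
    funext j
    simp only [Pi.sub_apply, Pi.smul_apply, Pi.add_apply, smul_eq_mul]
    ring
  rw [hmid, h.smul, abs_of_pos (by norm_num)]
  have := h.triangle (x i - x 0) (x i - b)
  linarith

/-! ### Outer normals and the obstruction to translation -/

theorem fderiv_dotProduct {n : ℕ} {f : (Fin n → ℝ) → ℝ} {q w : Fin n → ℝ}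
    (h : HasFDerivAt f (LinearMap.toContinuousLinearMap (dotProductBilin ℝ ℝ w)) q) :
    (fun i => fderiv ℝ f q (Pi.single i 1)) = w := by
  funext i
  rw [h.fderiv]
  simp [dotProductBilin]

/-- At a smooth boundary point the outer normal belongs to the dual body and supports `K`. -/
theorem DualPair.outerNormal_spec {n : ℕ} {K K' : Set (Fin n → ℝ)} (h : DualPair K K')
    {q : Fin n → ℝ} (hq : q ∈ smoothBoundary K) :
    outerNormal K q ∈ K' ∧ outerNormal K q ⬝ᵥ q = 1 := by
  obtain ⟨hq1, hq2⟩ := hq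
  rw [h.mem_frontier] at hq1
  rw [h.polarBody_eq, h.finslerNorm_eq] at hq2
  obtain ⟨p, hp, hpq⟩ := h.attained q
  suffices outerNormal K q = p by rw [this, hpq]; exact ⟨hp, hq1⟩
  unfold outerNormal
  rw [h.polarBody_eq, h.finslerNorm_eq]
  apply fderiv_dotProduct
  have hlin : HasFDerivAt (fun x => p ⬝ᵥ x)
      (LinearMap.toContinuousLinearMap (dotProductBilin ℝ ℝ p)) q :=
    (LinearMap.toContinuousLinearMap (dotProductBilin ℝ ℝ p)).hasFDerivAt
  -- The norm minus a functional attaining it at `q` is minimal there, so the two derivatives agree.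
  have hmin : IsLocalMin (fun x => gauge K x - p ⬝ᵥ x) q := by
    refine Filter.Eventually.of_forall fun x => ?_
    have := h.pairing_le (x := x) hp
    simp only [hpq]
    linarith
  have := hmin.hasFDerivAt_eq_zero (hq2.hasFDerivAt.sub hlin)
  rw [← sub_eq_zero.1 this]
  exact hq2.hasFDerivAt

/-- If all `q i - t` were interior, every outer normal would pair positively with `t`. But the
momenta close up, so a positive combination of the normals vanishes. -/
theorem IsClassicalTrajectory.nonTranslatable {n m : ℕ} {K K' T : Set (Fin n → ℝ)}
    (h : DualPair K K') {q p : Fin m → Fin n → ℝ} (hqp : IsClassicalTrajectory K T q p) :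
    q ∈ nonTranslatable K m := by
  rintro ⟨t, ht⟩
  choose r hr hrp using hqp.reflection
  have hpos : ∀ i, 0 < r i * (outerNormal K (q i) ⬝ᵥ t) := by
    intro i
    obtain ⟨h1, h2⟩ := h.outerNormal_spec (hqp.coord_mem i)
    have h3 := (h.mem_interior _).1 (ht i)
    have h4 := h.pairing_le (x := q i - t) h1
    rw [dotProduct_sub, h2] at h4
    exact mul_pos (hr i) (by linarith)
  have hzero : ∑ i, (p (finRotate m i) - p i) = 0 := by
    rw [Finset.sum_sub_distrib, Equiv.sum_comp (finRotate m) p, sub_self]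
  have h0 : ∑ i, r i * (outerNormal K (q i) ⬝ᵥ t) = 0 := by
    have : ∑ i, r i * (outerNormal K (q i) ⬝ᵥ t) = -((∑ i, (p (finRotate m i) - p i)) ⬝ᵥ t) := by
      rw [sum_dotProduct, ← Finset.sum_neg_distrib]
      refine Finset.sum_congr rfl fun i _ => ?_
      rw [hrp, neg_dotProduct, smul_dotProduct, neg_neg, smul_eq_mul]
    rw [this, hzero, zero_dotProduct, neg_zero]
  have : Nonempty (Fin m) := ⟨⟨0, by have := hqp.two_le; omega⟩⟩
  exact absurd h0 (Finset.sum_pos (fun i _ => hpos i) Finset.univ_nonempty).ne'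

/-! ### Flags and their trajectories -/

/-- Antiperiodic sequences of normals `W` and vertices `V` such that `W j` is the normal of a
facet with vertices `V j, …, V (j + n - 1)`. -/
structure IsFlag {n : ℕ} (W V : ℕ → Fin n → ℝ) : Prop where
  antiperiodic_left : ∀ i, W (i + n) = -W i
  antiperiodic_right : ∀ i, V (i + n) = -V i
  pairing : ∀ j, ∀ i < n, W j ⬝ᵥ V (j + i) = 1

namespace IsFlag

variable {n : ℕ} {W V : ℕ → Fin n → ℝ}

/-- A vertex V_{j+n-1} lies on the facets with normals W_j, …, W_{j+n-1}, which gives the shift by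
`n - 1`. -/
theorem dual (h : IsFlag W V) : IsFlag (fun j => V (j + (n - 1))) W where
  antiperiodic_left i := by rw [add_right_comm]; exact h.antiperiodic_right _
  antiperiodic_right := h.antiperiodic_left
  pairing j i hi := by
    have := h.pairing (j + i) (n - 1 - i) (by omega)
    rwa [show j + i + (n - 1 - i) = j + (n - 1) by omega, dotProduct_comm] at this

theorem pairing_neg (h : IsFlag W V) {j i : ℕ} (hij : i < j) (hji : j ≤ i + n) :
    W j ⬝ᵥ V i = -1 := by
  have := h.pairing j (i + n - j) (by omega)
  rw [show j + (i + n - j) = i + n by omega, h.antiperiodic_right, dotProduct_neg] at this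
  linarith

end IsFlag

/-- Vectors whose pairings with the columns `v` have the triangular sign pattern give the
coordinates with respect to these columns. -/
theorem sum_pairing_smul {n : ℕ} {w : ℕ → Fin n → ℝ} {v : ℕ → Fin n → ℝ}
    (hpos : ∀ j ≤ n, ∀ i < n, j ≤ i → w j ⬝ᵥ v i = 1)
    (hneg : ∀ j ≤ n, ∀ i < n, i < j → w j ⬝ᵥ v i = -1) (x : Fin n → ℝ) :
    ∑ i : Fin n, (((1 / 2 : ℝ) • (w i - w (i + 1))) ⬝ᵥ x) • v i = x := by
  set A : Matrix (Fin n) (Fin n) ℝ := Matrix.of fun a => (1 / 2 : ℝ) • (w a - w (a + 1)) with hA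
  set B : Matrix (Fin n) (Fin n) ℝ := Matrix.of fun b i => v i b with hB
  have hAB : A * B = 1 := by
    ext a i
    have e : (A * B) a i = ((1 / 2 : ℝ) • (w a - w (a + 1))) ⬝ᵥ v i := rfl
    rw [e, smul_dotProduct, sub_dotProduct, Matrix.one_apply]
    rcases lt_trichotomy a i with hlt | rfl | hlt
    · have hlt' : (a : ℕ) < i := hlt
      rw [hpos a a.2.le i i.2 hlt'.le, hpos (a + 1) a.2 i i.2 hlt', if_neg hlt.ne]
      norm_num
    · rw [hpos a a.2.le a a.2 le_rfl, hneg (a + 1) a.2 a a.2 (Nat.lt_succ_self _), if_pos rfl]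
      norm_num
    · have hlt' : (i : ℕ) < a := hlt
      rw [hneg a a.2.le i i.2 hlt', hneg (a + 1) a.2 i i.2 (by omega), if_neg hlt.ne']
      norm_num
  -- A one-sided inverse of a square matrix is two-sided; this is where the vectors `v i` turn out
  -- to span.
  have hBA : B * A = 1 := mul_eq_one_comm.1 hAB
  have hx : B *ᵥ (A *ᵥ x) = x := by rw [Matrix.mulVec_mulVec, hBA, Matrix.one_mulVec]
  conv_rhs => rw [← hx]
  funext b
  simp only [Finset.sum_apply, Pi.smul_apply, smul_eq_mul]
  refine Finset.sum_congr rfl fun i _ => mul_comm _ _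

/-- The weighted sum of `n` consecutive terms of the sequence `V`, from index `j` on. -/
def windowSum {n : ℕ} (t : ℕ → ℝ) (V : ℕ → Fin n → ℝ) (j : ℕ) : Fin n → ℝ :=
  ∑ i ∈ Finset.range n, t (j + i) • V (j + i)

/-- Moving the window drops `t j • V j` and gains the same vector with the opposite sign. -/
theorem windowSum_succ {n : ℕ} {t : ℕ → ℝ} {V : ℕ → Fin n → ℝ} (ht : ∀ i, t (i + n) = t i)
    (hV : ∀ i, V (i + n) = -V i) (j : ℕ) :
    windowSum t V (j + 1) = windowSum t V j - (2 * t j) • V j := by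
  have h1 : ∑ i ∈ Finset.range n, t (j + 1 + i) • V (j + 1 + i) + t j • V j =
      ∑ i ∈ Finset.range n, t (j + i) • V (j + i) + t (j + n) • V (j + n) := by
    rw [← Finset.sum_range_succ (fun i => t (j + i) • V (j + i)),
      Finset.sum_range_succ' (fun i => t (j + i) • V (j + i))]
    simp [add_right_comm, add_assoc]
  rw [ht, hV] at h1
  rw [windowSum, windowSum, eq_sub_of_add_eq h1, two_mul, add_smul, smul_neg]
  abel

theorem windowSum_add {n : ℕ} {t : ℕ → ℝ} {V : ℕ → Fin n → ℝ} (ht : ∀ i, t (i + n) = t i)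
    (hV : ∀ i, V (i + n) = -V i) (j : ℕ) : windowSum t V (j + n) = -windowSum t V j := by
  rw [windowSum, windowSum, ← Finset.sum_neg_distrib]
  refine Finset.sum_congr rfl fun i _ => ?_
  rw [add_right_comm, ht, hV, smul_neg]

theorem sum_window {n : ℕ} {t : ℕ → ℝ} (ht : ∀ i, t (i + n) = t i) (j : ℕ) :
    ∑ i ∈ Finset.range n, t (j + i) = ∑ i ∈ Finset.range n, t i := by
  induction j with
  | zero => simp
  | succ j ih =>
    rw [← ih]
    have h1 := Finset.sum_range_succ (fun i => t (j + i)) n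
    rw [Finset.sum_range_succ' (fun i => t (j + i)), ht] at h1
    simpa [add_right_comm, add_assoc] using h1

/-- Near a point with positive weights the norm is linear. -/
theorem IsFlag.gauge_eventuallyEq {n : ℕ} {W V : ℕ → Fin n → ℝ} (h : IsFlag W V)
    {K K' : Set (Fin n → ℝ)} (hK : DualPair K K') (hW : ∀ j, W j ∈ K') (hV : ∀ i, V i ∈ K)
    {t : ℕ → ℝ} (ht : ∀ i, 0 < t i) (j : ℕ) :
    gauge K =ᶠ[𝓝 (windowSum t V j)] fun x => W j ⬝ᵥ x := by
  -- The half differences of consecutive normals form the dual basis, so `c i` is the coordinate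
  -- along `V (j + i)`; it equals `t (j + i) > 0` at the window sum and stays positive nearby.
  set c : Fin n → (Fin n → ℝ) → ℝ :=
    fun i x => ((1 / 2 : ℝ) • (W (j + i) - W (j + (i + 1)))) ⬝ᵥ x with hc
  have hexp : ∀ x, ∑ i, c i x • V (j + i) = x := by
    refine sum_pairing_smul (w := fun i => W (j + i)) (v := fun i => V (j + i)) ?_ ?_
    · intro a _ i hi hai
      have := h.pairing (j + a) (i - a) (by omega)
      rwa [show j + a + (i - a) = j + i by omega] at this
    · intro a ha i _ hia
      exact h.pairing_neg (by omega) (by omega)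
  have hcoord : ∀ i, c i (windowSum t V j) = t (j + i) := by
    intro i
    have hterm : ∀ a : ℕ, a < n → ((1 / 2 : ℝ) • (W (j + i) - W (j + (i + 1)))) ⬝ᵥ V (j + a) =
        if a = i then 1 else 0 := by
      intro a ha
      have hi := i.2
      rw [smul_dotProduct, sub_dotProduct]
      rcases lt_trichotomy a i with hlt | rfl | hlt
      · rw [h.pairing_neg (by omega) (by omega), h.pairing_neg (by omega) (by omega),
          if_neg hlt.ne]
        norm_num
      · rw [h.pairing_neg (j := j + (i + 1)) (by omega) (by omega), if_pos rfl]
        have := h.pairing (j + i) 0 (by omega)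
        rw [add_zero] at this
        rw [this]
        norm_num
      · have e1 := h.pairing (j + i) (a - i) (by omega)
        have e2 := h.pairing (j + (i + 1)) (a - (i + 1)) (by omega)
        rw [show j + i + (a - i) = j + a by omega] at e1
        rw [show j + (i + 1) + (a - (i + 1)) = j + a by omega] at e2
        rw [e1, e2, if_neg hlt.ne']
        norm_num
    simp only [hc, windowSum, dotProduct_sum, dotProduct_smul]
    rw [Finset.sum_congr rfl fun a ha => by rw [hterm a (Finset.mem_range.1 ha)]]
    simp
  have hcont : ∀ i, Continuous (c i) := fun i => by
    simp only [hc]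
    exact Continuous.dotProduct continuous_const continuous_id
  have hev : ∀ᶠ x in 𝓝 (windowSum t V j), ∀ i, 0 < c i x := by
    refine Filter.eventually_all.2 fun i => (hcont i).continuousAt.eventually_const_lt ?_
    rw [hcoord]
    exact ht _
  filter_upwards [hev] with x hx
  refine le_antisymm ?_ (hK.pairing_le (hW j))
  obtain ⟨p, hp, hpx⟩ := hK.attained x
  rw [← hpx]
  conv_lhs => rw [← hexp x]
  conv_rhs => rw [← hexp x]
  simp only [dotProduct_sum, dotProduct_smul, smul_eq_mul]
  -- No functional in `K'` exceeds 1 on any `V (j + i)`, while `W j` equals 1 on all of them.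
  refine Finset.sum_le_sum fun i _ => mul_le_mul_of_nonneg_left ?_ (hx i).le
  rw [h.pairing j i i.2]
  exact (hK.pairing_le hp).trans ((hK.mem _).1 (hV _))

theorem IsFlag.smooth {n : ℕ} {W V : ℕ → Fin n → ℝ} (h : IsFlag W V)
    {K K' : Set (Fin n → ℝ)} (hK : DualPair K K') (hW : ∀ j, W j ∈ K') (hV : ∀ i, V i ∈ K)
    {t : ℕ → ℝ} (ht : ∀ i, 0 < t i) (htn : ∀ i, t (i + n) = t i)
    (hsum : ∑ i ∈ Finset.range n, t i = 1) (j : ℕ) :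
    windowSum t V j ∈ smoothBoundary K ∧ outerNormal K (windowSum t V j) = W j := by
  have hev := h.gauge_eventuallyEq hK hW hV ht j
  have hlin : HasFDerivAt (fun x => W j ⬝ᵥ x)
      (LinearMap.toContinuousLinearMap (dotProductBilin ℝ ℝ (W j))) (windowSum t V j) :=
    (LinearMap.toContinuousLinearMap (dotProductBilin ℝ ℝ (W j))).hasFDerivAt
  have hder := hlin.congr_of_eventuallyEq hev
  refine ⟨⟨?_, ?_⟩, ?_⟩
  · rw [hK.mem_frontier, hev.eq_of_nhds, ← hsum, ← sum_window htn j]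
    simp only [windowSum, dotProduct_sum, dotProduct_smul, smul_eq_mul]
    refine Finset.sum_congr rfl fun i hi => ?_
    rw [h.pairing j i (Finset.mem_range.1 hi), mul_one]
  · rw [hK.polarBody_eq, hK.finslerNorm_eq]
    exact hder.differentiableAt
  · unfold outerNormal
    rw [hK.polarBody_eq, hK.finslerNorm_eq]
    exact fderiv_dotProduct hder

section Trajectory

variable {n : ℕ} {W V : ℕ → Fin n → ℝ} {K K' : Set (Fin n → ℝ)} {t s : ℕ → ℝ}

theorem IsFlag.isClassicalTrajectory (h : IsFlag W V) (hK : DualPair K K')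
    (hW : ∀ j, W j ∈ K') (hV : ∀ i, V i ∈ K)
    (ht : ∀ i, 0 < t i) (htn : ∀ i, t (i + n) = t i) (hts : ∑ i ∈ Finset.range n, t i = 1)
    (hs : ∀ i, 0 < s i) (hsn : ∀ i, s (i + n) = s i) (hss : ∑ i ∈ Finset.range n, s i = 1) :
    IsClassicalTrajectory (m := 2 * n) K K' (fun i => windowSum t V i)
      (fun i => windowSum s W i) := by
  have hn := hK.pos_dim
  have hq := h.smooth hK hW hV ht htn hts
  have hp := h.dual.smooth hK.symm (fun j => hV _) hW hs hsn hss
  have hperq : ∀ i, windowSum t V (i + 2 * n) = windowSum t V i := fun i => by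
    rw [two_mul, ← add_assoc, windowSum_add htn h.antiperiodic_right,
      windowSum_add htn h.antiperiodic_right, neg_neg]
  have hperp : ∀ i, windowSum s W (i + 2 * n) = windowSum s W i := fun i => by
    rw [two_mul, ← add_assoc, windowSum_add hsn h.antiperiodic_left,
      windowSum_add hsn h.antiperiodic_left, neg_neg]
  refine ⟨by omega, fun i => (hq i).1, fun i => (hp i).1, fun i => ⟨2 * t i, ?_, ?_⟩,
    fun i => ⟨2 * s i, ?_, ?_⟩⟩
  · linarith [ht i]
  -- The normal at the momentum of index i+1 is V_{i+1+(n-1)} = V_{i+n} = -V_i, the direction of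
  -- flight.
  · rw [apply_finRotate hperq, apply_finRotate hperp, (hp (i + 1)).2,
      windowSum_succ htn h.antiperiodic_right,
      show (i : ℕ) + 1 + (n - 1) = i + n by omega, h.antiperiodic_right, smul_neg]
    abel
  · linarith [hs i]
  · rw [apply_finRotate hperp, (hq i).2, windowSum_succ hsn h.antiperiodic_left]
    abel

theorem IsFlag.closedLength_eq (h : IsFlag W V) (hK : DualPair K K')
    (hW : ∀ j, W j ∈ K') (hV : ∀ i, V i ∈ K)
    (ht : ∀ i, 0 < t i) (htn : ∀ i, t (i + n) = t i) (hts : ∑ i ∈ Finset.range n, t i = 1) :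
    closedLength (m := 2 * n) K' (fun i => windowSum t V i) = 4 := by
  have hn := hK.pos_dim
  have hperq : ∀ i, windowSum t V (i + 2 * n) = windowSum t V i := fun i => by
    rw [two_mul, ← add_assoc, windowSum_add htn h.antiperiodic_right,
      windowSum_add htn h.antiperiodic_right, neg_neg]
  have hunit : ∀ i, gauge K (V i) = 1 := by
    intro i
    have h1 := hK.pairing_le (x := V i) (hW i)
    have h2 := h.pairing i 0 hn
    rw [add_zero] at h2
    exact le_antisymm ((hK.mem _).1 (hV i)) (h2 ▸ h1)
  have hterm : ∀ i : Fin (2 * n), finslerNorm K' (windowSum t V (finRotate (2 * n) i : ℕ) -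
      windowSum t V i) = 2 * t i := by
    intro i
    rw [hK.finslerNorm_eq, apply_finRotate hperq, windowSum_succ htn h.antiperiodic_right,
      hK.sub_comm, sub_sub_cancel, hK.smul, hunit, mul_one, abs_of_pos (by linarith [ht i])]
  rw [closedLength, Finset.sum_congr rfl fun i _ => hterm i,
    Fin.sum_univ_eq_sum_range (fun i => 2 * t i), two_mul n, Finset.sum_range_add,
    ← Finset.mul_sum, ← Finset.mul_sum, sum_window htn, hts]
  norm_num

end Trajectory

/-! ### From words to flags -/

/-- Reads the list as x_0 y_0 x_1 … y_{N-1} x_N, which turns the sign rule into a triangular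
pattern. Values of the sequences beyond these ranges are irrelevant. -/
theorem Alternates.exists_indexing {n : ℕ} {κ : Bool} {l : List (Letter n)}
    (h : Alternates κ l) : ∃ (N : ℕ) (x y : ℕ → Letter n), l.length = 2 * N + 1 ∧
      (∀ j ≤ N, x j ∈ l ∧ (x j).kind = κ) ∧ (∀ i < N, y i ∈ l ∧ (y i).kind = !κ) ∧
      weightSum κ l = ∑ j ∈ Finset.range (N + 1), (x j).wt ∧
      weightSum (!κ) l = ∑ i ∈ Finset.range N, (y i).wt ∧
      vecSum κ l = ∑ j ∈ Finset.range (N + 1), (x j).wt • (x j).vec ∧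
      vecSum (!κ) l = ∑ i ∈ Finset.range N, (y i).wt • (y i).vec ∧
      (l.Pairwise Compat → ∀ j ≤ N, ∀ i < N,
        (j ≤ i → Compat (x j) (y i)) ∧ (i < j → Compat (y i) (x j))) := by
  have hκ : (!κ) ≠ κ := by cases κ <;> simp
  induction h with
  | single a ha =>
    refine ⟨0, fun _ => a, fun _ => a, rfl, fun _ _ => ⟨by simp, ha⟩, by simp, ?_, ?_, ?_, ?_,
      by simp⟩
    · simp [ha]
    · simp [ha]
    · simp [ha]
    · simp [ha]
  | cons a b l ha hb _ ih =>
    obtain ⟨N, x, y, hlen, hx, hy, e₁, e₂, e₃, e₄, hc⟩ := ih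
    refine ⟨N + 1, fun j => Nat.casesOn j a x, fun i => Nat.casesOn i b y, ?_, ?_, ?_, ?_, ?_, ?_,
      ?_, ?_⟩
    · simp only [List.length_cons, hlen]; ring
    · rintro (_ | j) hj
      · exact ⟨by simp, ha⟩
      · have := hx j (by omega)
        exact ⟨by simp [this.1], this.2⟩
    · rintro (_ | j) hj
      · exact ⟨by simp, hb⟩
      · have := hy j (by omega)
        exact ⟨by simp [this.1], this.2⟩
    · rw [Finset.sum_range_succ']
      simp [ha, hb, e₁, add_comm]
    · rw [Finset.sum_range_succ']
      simp [ha, hb, e₂, add_comm]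
    · rw [Finset.sum_range_succ']
      simp [ha, hb, e₃, add_comm]
    · rw [Finset.sum_range_succ']
      simp [ha, hb, e₄, add_comm]
    · intro hp
      simp only [List.pairwise_cons, List.mem_cons, forall_eq_or_imp] at hp
      obtain ⟨⟨hab, hal⟩, hbl, hl⟩ := hp
      rintro (_ | j) hj (_ | i) hi
      · exact ⟨fun _ => hab, fun h => absurd h (by simp)⟩
      · exact ⟨fun _ => hal _ (hy i (by omega)).1, fun h => absurd h (by simp)⟩
      · exact ⟨fun h => absurd h (by simp), fun _ => hbl _ (hx j (by omega)).1⟩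
      · have := hc hl j (by omega) i (by omega)
        exact ⟨fun h => this.1 (by omega), fun h => this.2 (by omega)⟩

/-- The antiperiodic extension of the first `n` terms of a sequence. -/
def antiExtend (n : ℕ) (v : ℕ → Fin n → ℝ) (i : ℕ) : Fin n → ℝ :=
  (-1 : ℝ) ^ (i / n) • v (i % n)

theorem antiExtend_add {n : ℕ} (hn : 0 < n) (v : ℕ → Fin n → ℝ) (i : ℕ) :
    antiExtend n v (i + n) = -antiExtend n v i := by
  simp [antiExtend, Nat.add_div_right _ hn, pow_succ]

theorem antiExtend_of_lt {n : ℕ} (v : ℕ → Fin n → ℝ) {i : ℕ} (hi : i < n) :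
    antiExtend n v i = v i := by
  simp [antiExtend, Nat.div_eq_of_lt hi, Nat.mod_eq_of_lt hi]

theorem antiExtend_mem {n : ℕ} (hn : 0 < n) {K K' : Set (Fin n → ℝ)} (hK : DualPair K K')
    {v : ℕ → Fin n → ℝ} (hv : ∀ i < n, v i ∈ K) (i : ℕ) : antiExtend n v i ∈ K := by
  have h := hv (i % n) (Nat.mod_lt _ hn)
  rcases neg_one_pow_eq_or ℝ (i / n) with e | e
  · simpa [antiExtend, e] using h
  · simpa [antiExtend, e] using hK.neg_mem h

theorem isFlag_antiExtend {n : ℕ} (hn : 0 < n) {w v : ℕ → Fin n → ℝ}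
    (hpos : ∀ j ≤ n, ∀ i < n, j ≤ i → w j ⬝ᵥ v i = 1)
    (hneg : ∀ j ≤ n, ∀ i < n, i < j → w j ⬝ᵥ v i = -1) :
    IsFlag (antiExtend n w) (antiExtend n v) where
  antiperiodic_left := antiExtend_add hn w
  antiperiodic_right := antiExtend_add hn v
  pairing j i hi := by
    obtain ⟨a, r, hr, rfl⟩ : ∃ a r, r < n ∧ j = r + n * a :=
      ⟨j / n, j % n, Nat.mod_lt _ hn, (Nat.mod_add_div j n).symm⟩
    have hsq : (-1 : ℝ) ^ a * (-1 : ℝ) ^ a = 1 := by rw [← mul_pow]; simp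
    have e₁ : antiExtend n w (r + n * a) = (-1 : ℝ) ^ a • w r := by
      simp [antiExtend, Nat.add_mul_div_left _ _ hn, Nat.div_eq_of_lt hr, Nat.mod_eq_of_lt hr]
    rw [e₁]
    rcases Nat.lt_or_ge (r + i) n with h | h
    · have e₂ : antiExtend n v (r + n * a + i) = (-1 : ℝ) ^ a • v (r + i) := by
        rw [show r + n * a + i = r + i + n * a by ring]
        simp [antiExtend, Nat.add_mul_div_left _ _ hn, Nat.div_eq_of_lt h, Nat.mod_eq_of_lt h]
      rw [e₂, smul_dotProduct, dotProduct_smul, hpos r hr.le _ h (by omega)]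
      simpa using hsq
    -- Past the end of the block the extension changes sign, and so does the pairing, since `c < r`.
    · obtain ⟨c, hc⟩ := Nat.exists_eq_add_of_le h
      have hcn : c < n := by omega
      have e₂ : antiExtend n v (r + n * a + i) = -((-1 : ℝ) ^ a • v c) := by
        rw [show r + n * a + i = c + n * a + n by linarith, antiExtend_add hn]
        simp [antiExtend, Nat.add_mul_div_left _ _ hn, Nat.div_eq_of_lt hcn,
          Nat.mod_eq_of_lt hcn]
      rw [e₂, smul_dotProduct, dotProduct_neg, dotProduct_smul, hneg r hr.le _ hcn (by omega)]
      simpa using hsq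

/-- The triangular sign pattern forces the last normal to be opposite to the first. -/
theorem last_eq_neg_first {n : ℕ} {w v : ℕ → Fin n → ℝ}
    (hpos : ∀ j ≤ n, ∀ i < n, j ≤ i → w j ⬝ᵥ v i = 1)
    (hneg : ∀ j ≤ n, ∀ i < n, i < j → w j ⬝ᵥ v i = -1) : w n = -w 0 := by
  rw [eq_neg_iff_add_eq_zero]
  refine dotProduct_self_eq_zero.1 ?_
  conv_lhs =>
    rw [← sum_pairing_smul hpos hneg (w n + w 0)]
  rw [sum_pairing_smul hpos hneg]
  -- Only the second factor is expanded in the spanning vectors `v i`; the first pairs with each of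
  -- them to -1 + 1 = 0.
  conv_lhs =>
    arg 2
    rw [← sum_pairing_smul hpos hneg (w n + w 0)]
  rw [dotProduct_sum]
  refine Finset.sum_eq_zero fun i _ => ?_
  rw [dotProduct_smul, add_dotProduct, hneg n le_rfl i i.2 i.2, hpos 0 (Nat.zero_le _) i i.2
    (Nat.zero_le _)]
  simp

theorem sum_mod {n : ℕ} {M : Type*} [AddCommMonoid M] (f : ℕ → M) :
    ∑ i ∈ Finset.range n, f (i % n) = ∑ i ∈ Finset.range n, f i :=
  Finset.sum_congr rfl fun i hi => by rw [Nat.mod_eq_of_lt (Finset.mem_range.1 hi)]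

/-- A word yields a flag; the momentum `p` lies between the first two momenta of the billiard
trajectory of the flag. -/
theorem IsWord.exists_flag {n : ℕ} {K K' : Set (Fin n → ℝ)} (hK : DualPair K K')
    {l : List (Letter n)} {p q : Fin n → ℝ} (h : IsWord true K K' l (2 * n + 1) 1 1 p q) :
    ∃ (W V : ℕ → Fin n → ℝ) (t s : ℕ → ℝ) (σ : ℝ), IsFlag W V ∧ (∀ j, W j ∈ K') ∧
      (∀ i, V i ∈ K) ∧ (∀ i, 0 ≤ t i) ∧ (∀ i, 0 ≤ s i) ∧ (∀ i, t (i + n) = t i) ∧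
      (∀ i, s (i + n) = s i) ∧ ∑ i ∈ Finset.range n, t i = 1 ∧ ∑ i ∈ Finset.range n, s i = 1 ∧
      0 ≤ σ ∧ σ ≤ s 0 ∧ windowSum t V 0 = q ∧ windowSum s W 0 - (2 * σ) • W 0 = p := by
  have hn := hK.pos_dim
  obtain ⟨N, x, y, hlen, hx, hy, e₁, e₂, e₃, e₄, hc⟩ := h.alternates.exists_indexing
  obtain rfl : n = N := by have := h.length; omega
  have hc := hc h.compat
  have hpos : ∀ j ≤ n, ∀ i < n, j ≤ i → (x j).vec ⬝ᵥ (y i).vec = 1 := fun j hj i hi hji => by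
    have := (hc j hj i hi).1 hji (by rw [(hx j hj).2, (hy i hi).2]; simp)
    simpa [(hx j hj).2] using this
  have hneg : ∀ j ≤ n, ∀ i < n, i < j → (x j).vec ⬝ᵥ (y i).vec = -1 := fun j hj i hi hij => by
    have := (hc j hj i hi).2 hij (by rw [(hx j hj).2, (hy i hi).2]; simp)
    rw [dotProduct_comm]
    simpa [(hy i hi).2] using this
  have hx0 : ∀ j ≤ n, 0 ≤ (x j).wt := fun j hj => h.nonneg _ (hx j hj).1
  have hy0 : ∀ i < n, 0 ≤ (y i).wt := fun i hi => h.nonneg _ (hy i hi).1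
  have hlast := last_eq_neg_first (w := fun j => (x j).vec) (v := fun i => (y i).vec) hpos hneg
  -- The last momentum is the negative of the first, so its weight is added to that of the first and
  -- subtracted twice through `σ`.
  set s₀ : ℕ → ℝ := fun i => (x i).wt + if i = 0 then (x n).wt else 0 with hs₀
  refine ⟨antiExtend n fun j => (x j).vec, antiExtend n fun i => (y i).vec,
    fun i => (y (i % n)).wt, fun i => s₀ (i % n), (x n).wt, isFlag_antiExtend hn hpos hneg,
    antiExtend_mem hn hK.symm fun j hj => h.mem_true _ (hx j hj.le).1 (hx j hj.le).2,
    antiExtend_mem hn hK fun i hi => h.mem_false _ (hy i hi).1 (hy i hi).2,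
    fun i => hy0 _ (Nat.mod_lt _ hn), fun i => ?_, by simp, by simp, ?_, ?_, hx0 n le_rfl, ?_,
    ?_, ?_⟩
  · have h1 := hx0 (i % n) (Nat.mod_lt _ hn).le
    have h2 := hx0 n le_rfl
    simp only [hs₀]
    split_ifs <;> linarith
  · rw [sum_mod fun i => (y i).wt, ← h.weight_false]
    exact e₂.symm
  · rw [sum_mod s₀, ← h.weight_true, e₁, Finset.sum_range_succ, hs₀, Finset.sum_add_distrib]
    simp [hn]
  · have h1 := hx0 0 (Nat.zero_le _)
    simp [hs₀, h1]
  · rw [← h.vec_false, windowSum]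
    refine Eq.trans (Finset.sum_congr rfl fun i hi => ?_) e₄.symm
    have hi := Finset.mem_range.1 hi
    rw [zero_add, antiExtend_of_lt _ hi, Nat.mod_eq_of_lt hi]
  · rw [← h.vec_true, windowSum, e₃, antiExtend_of_lt _ hn, Finset.sum_range_succ]
    have hterm : ∀ i ∈ Finset.range n, s₀ ((0 + i) % n) •
        antiExtend n (fun j => (x j).vec) (0 + i) =
        (x i).wt • (x i).vec + if i = 0 then (x n).wt • (x 0).vec else 0 := by
      intro i hi
      have hi := Finset.mem_range.1 hi
      rw [zero_add, antiExtend_of_lt _ hi, Nat.mod_eq_of_lt hi, hs₀, add_smul]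
      split_ifs with h0
      · rw [h0]
      · simp
    rw [Finset.sum_congr rfl hterm, Finset.sum_add_distrib, hlast]
    simp only [Finset.sum_ite_eq', Finset.mem_range, hn, if_true]
    rw [two_mul, add_smul, smul_neg]
    abel

/-! ### Perturbation and the phase curve -/

/-- The weights of a flag can be made positive by a small perturbation. -/
theorem exists_pos_weights {n : ℕ} (hn : 0 < n) {W V : ℕ → Fin n → ℝ} {t s : ℕ → ℝ} {σ : ℝ}
    (ht : ∀ i, 0 ≤ t i) (hs : ∀ i, 0 ≤ s i) (htn : ∀ i, t (i + n) = t i)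
    (hsn : ∀ i, s (i + n) = s i) (hts : ∑ i ∈ Finset.range n, t i = 1)
    (hss : ∑ i ∈ Finset.range n, s i = 1) (hσ : 0 ≤ σ) (hσs : σ ≤ s 0)
    {U : Set ((Fin n → ℝ) × (Fin n → ℝ))}
    (hU : U ∈ 𝓝 (windowSum t V 0, windowSum s W 0 - (2 * σ) • W 0)) :
    ∃ (t' s' : ℕ → ℝ) (σ' : ℝ), (∀ i, 0 < t' i) ∧ (∀ i, 0 < s' i) ∧
      (∀ i, t' (i + n) = t' i) ∧ (∀ i, s' (i + n) = s' i) ∧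
      ∑ i ∈ Finset.range n, t' i = 1 ∧ ∑ i ∈ Finset.range n, s' i = 1 ∧
      0 ≤ σ' ∧ σ' ≤ s' 0 ∧ (windowSum t' V 0, windowSum s' W 0 - (2 * σ') • W 0) ∈ U := by
  have hn' : (0 : ℝ) < n := Nat.cast_pos.2 hn
  -- Mixing with the uniform weights `1 / n` makes all weights positive and keeps their total;
  -- scaling `σ` by `1 - ε` keeps it below the first weight.
  have hcont : Continuous fun ε : ℝ =>
      (windowSum (fun i => (1 - ε) * t i + ε / n) V 0,
        windowSum (fun i => (1 - ε) * s i + ε / n) W 0 - (2 * ((1 - ε) * σ)) • W 0) := by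
    unfold windowSum
    fun_prop
  have hlim := hcont.tendsto 0
  simp only [sub_zero, one_mul, zero_div, add_zero] at hlim
  obtain ⟨ε, hεU, hε⟩ := (((hlim.mono_left nhdsWithin_le_nhds).eventually hU).and
    (Ioo_mem_nhdsGT (zero_lt_one' ℝ))).exists
  have hsum : ∀ r : ℕ → ℝ, ∑ i ∈ Finset.range n, r i = 1 →
      ∑ i ∈ Finset.range n, ((1 - ε) * r i + ε / n) = 1 := by
    intro r hr
    rw [Finset.sum_add_distrib, ← Finset.mul_sum, hr, Finset.sum_const, Finset.card_range,
      nsmul_eq_mul, mul_div_cancel₀ _ hn'.ne']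
    ring
  have hε1 : 0 ≤ 1 - ε := by linarith [hε.2]
  have hεn : 0 < ε / n := div_pos hε.1 hn'
  refine ⟨fun i => (1 - ε) * t i + ε / n, fun i => (1 - ε) * s i + ε / n, (1 - ε) * σ,
    fun i => ?_, fun i => ?_, fun i => ?_, fun i => ?_, hsum t hts, hsum s hss,
    mul_nonneg hε1 hσ, ?_, hεU⟩
  · have := mul_nonneg hε1 (ht i)
    linarith
  · have := mul_nonneg hε1 (hs i)
    linarith
  · simp only [htn]
  · simp only [hsn]
  · have := mul_le_mul_of_nonneg_left hσs hε1
    linarith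

theorem sub_smul_mem_segment {E : Type*} [AddCommGroup E] [Module ℝ E] (x v : E) {c d : ℝ}
    (hc : 0 ≤ c) (hcd : c ≤ d) (hd : 0 < d) : x - c • v ∈ segment ℝ x (x - d • v) := by
  rw [segment_eq_image']
  refine ⟨c / d, ⟨div_nonneg hc hd.le, (div_le_one hd).2 hcd⟩, ?_⟩
  beta_reduce
  rw [sub_sub_cancel_left, smul_neg, smul_smul, div_mul_cancel₀ _ hd.ne', sub_eq_add_neg]

section Phase

variable {n : ℕ} {W V : ℕ → Fin n → ℝ} {t s : ℕ → ℝ}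

theorem windowSum_periodic (ht : ∀ i, t (i + n) = t i) (hV : ∀ i, V (i + n) = -V i) (i : ℕ) :
    windowSum t V (i + 2 * n) = windowSum t V i := by
  rw [two_mul, ← add_assoc, windowSum_add ht hV, windowSum_add ht hV, neg_neg]

/-- Points passed while the momentum changes. -/
theorem mem_phaseCurve_bounce (hn : 0 < n) (h : IsFlag W V) (hs : ∀ i, 0 < s i)
    (hsn : ∀ i, s (i + n) = s i) {σ : ℝ} (hσ : 0 ≤ σ) (hσs : σ ≤ s 0) :
    (windowSum t V 0, windowSum s W 0 - (2 * σ) • W 0) ∈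
      phaseCurve (m := 2 * n) (fun i => windowSum t V i) (fun i => windowSum s W i) := by
  refine Set.mem_iUnion.2 ⟨⟨0, by omega⟩, .inr ?_⟩
  beta_reduce
  rw [apply_finRotate (windowSum_periodic hsn h.antiperiodic_left),
    windowSum_succ hsn h.antiperiodic_left, ← Prod.image_mk_segment_right]
  exact ⟨_, sub_smul_mem_segment _ _ (by linarith) (by linarith) (by linarith [hs 0]), rfl⟩

/-- Points passed while the coordinate changes. -/
theorem mem_phaseCurve_flight (hn : 0 < n) (h : IsFlag W V) (ht : ∀ i, 0 < t i)
    (htn : ∀ i, t (i + n) = t i) (hsn : ∀ i, s (i + n) = s i) {σ : ℝ} (hσ : 0 ≤ σ)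
    (hσt : σ ≤ t 0) :
    (-(windowSum t V 0 - (2 * σ) • V 0), windowSum s W (n + 1)) ∈
      phaseCurve (m := 2 * n) (fun i => windowSum t V i) (fun i => windowSum s W i) := by
  -- Bounce `n` is half a period later, where the trajectory has changed sign; this accounts for the
  -- minus sign of the coordinate.
  refine Set.mem_iUnion.2 ⟨⟨n, by omega⟩, .inl ?_⟩
  have e₁ : windowSum t V n = -windowSum t V 0 := by
    simpa using windowSum_add htn h.antiperiodic_right 0
  have e₂ : V n = -V 0 := by simpa using h.antiperiodic_right 0
  have e₃ : t n = t 0 := by simpa using htn 0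
  beta_reduce
  rw [apply_finRotate (windowSum_periodic hsn h.antiperiodic_left),
    apply_finRotate (windowSum_periodic htn h.antiperiodic_right),
    windowSum_succ htn h.antiperiodic_right, ← Prod.image_mk_segment_left, e₁, e₂, e₃]
  refine ⟨_, sub_smul_mem_segment (c := 2 * σ) _ _ (by linarith) (by linarith)
    (by linarith [ht 0]), ?_⟩
  rw [smul_neg, neg_sub, sub_neg_eq_add, neg_add_eq_sub]

end Phase

/-- A flag with positive weights whose trajectory meets a given neighborhood. -/
theorem exists_flag_meeting {n : ℕ} {K K' : Set (Fin n → ℝ)} (hK : DualPair K K')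
    (hw : HasWords K K') (hw' : HasWords K' K) {q p : Fin n → ℝ}
    (hqp : (q, p) ∈ frontier (K ×ˢ K')) {U : Set ((Fin n → ℝ) × (Fin n → ℝ))}
    (hU : U ∈ 𝓝 (q, p)) :
    ∃ (W V : ℕ → Fin n → ℝ) (t s : ℕ → ℝ), IsFlag W V ∧ (∀ j, W j ∈ K') ∧
      (∀ i, V i ∈ K) ∧ (∀ i, 0 < t i) ∧ (∀ i, 0 < s i) ∧ (∀ i, t (i + n) = t i) ∧
      (∀ i, s (i + n) = s i) ∧ ∑ i ∈ Finset.range n, t i = 1 ∧ ∑ i ∈ Finset.range n, s i = 1 ∧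
      (phaseCurve (m := 2 * n) (fun i => windowSum t V i) (fun i => windowSum s W i) ∩
        U).Nonempty := by
  have hn := hK.pos_dim
  rw [frontier_prod_eq, hK.isClosed.closure_eq, hK.symm.isClosed.closure_eq] at hqp
  rcases hqp with ⟨hq, hp⟩ | ⟨hq, hp⟩
  · have hq : gauge K (-q) ≤ 1 := by rw [hK.neg]; exact (hK.mem q).1 hq
    -- With the two bodies exchanged, `p` is the boundary coordinate and `-q` the momentum. The
    -- bounce of the resulting flag becomes a flight of its dual.
    obtain ⟨l, hl⟩ := hw' p (-q) ((hK.symm.mem_frontier p).1 hp) hq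
    obtain ⟨W, V, t, s, σ, hf, hW, hV, ht, hs, htn, hsn, hts, hss, hσ, hσs, e₁, e₂⟩ :=
      hl.exists_flag hK.symm
    have hcont : Continuous fun z : (Fin n → ℝ) × (Fin n → ℝ) => (-z.2, z.1) := by fun_prop
    have hU' : (fun z : (Fin n → ℝ) × (Fin n → ℝ) => (-z.2, z.1)) ⁻¹' U ∈ 𝓝 (p, -q) :=
      hcont.continuousAt.preimage_mem_nhds (by simpa using hU)
    rw [← e₁, ← e₂] at hU'
    obtain ⟨t', s', σ', ht', hs', htn', hsn', hts', hss', hσ', hσs', hmem⟩ :=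
      exists_pos_weights hn ht hs htn hsn hts hss hσ hσs hU'
    have hsum : ∑ i ∈ Finset.range n, t' (i + (n - 1)) = 1 := by
      rw [← hts', ← sum_window htn' (n - 1)]
      exact Finset.sum_congr rfl fun i _ => by rw [add_comm]
    have hper : ∀ i, t' (i + n + (n - 1)) = t' (i + (n - 1)) := fun i => by
      rw [add_right_comm, htn']
    refine ⟨_, W, s', fun i => t' (i + (n - 1)), hf.dual, fun j => hV _, hW, hs', fun i => ht' _,
      hsn', hper, hss', hsum, _, mem_phaseCurve_flight hn hf.dual hs' hsn' hper hσ' hσs',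
      ?_⟩
    have e : windowSum (fun i => t' (i + (n - 1))) (fun j => V (j + (n - 1))) (n + 1) =
        windowSum t' V 0 := by
      rw [← windowSum_periodic htn' hf.antiperiodic_right 0]
      refine Finset.sum_congr rfl fun i _ => ?_
      beta_reduce
      rw [show n + 1 + i + (n - 1) = 0 + 2 * n + i by omega]
    rw [e]
    exact hmem
  · obtain ⟨l, hl⟩ := hw q p ((hK.mem_frontier q).1 hq) ((hK.mem' p).1 hp)
    obtain ⟨W, V, t, s, σ, hf, hW, hV, ht, hs, htn, hsn, hts, hss, hσ, hσs, e₁, e₂⟩ :=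
      hl.exists_flag hK
    rw [← e₁, ← e₂] at hU
    obtain ⟨t', s', σ', ht', hs', htn', hsn', hts', hss', hσ', hσs', hmem⟩ :=
      exists_pos_weights hn ht hs htn hsn hts hss hσ hσs hU
    exact ⟨W, V, t', s', hf, hW, hV, ht', hs', htn', hsn', hts', hss', _,
      mem_phaseCurve_bounce hn hf hs' hsn' hσ' hσs', hmem⟩

end Billiard

theorem mainTheorem7 {n : ℕ} (H : Set (Fin n → ℝ)) (hH : Billiard.IsHanner n H)
    (q₀ p₀ : Fin n → ℝ) (h₀ : (q₀, p₀) ∈ frontier (H ×ˢ Billiard.polarBody H))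
    (U : Set ((Fin n → ℝ) × (Fin n → ℝ))) (hU : U ∈ 𝓝 (q₀, p₀)) :
    ∃ (m : ℕ) (q p : Fin m → Fin n → ℝ),
      Billiard.IsClassicalTrajectory H (Billiard.polarBody H) q p ∧
      IsLeast (Billiard.candidateLengths H (Billiard.polarBody H))
        (Billiard.closedLength (Billiard.polarBody H) q) ∧
      (∀ (m' : ℕ) (q' p' : Fin m' → Fin n → ℝ),
        Billiard.IsClassicalTrajectory H (Billiard.polarBody H) q' p' →
          Billiard.closedLength (Billiard.polarBody H) q ≤
            Billiard.closedLength (Billiard.polarBody H) q') ∧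
      (Billiard.phaseCurve q p ∩ U).Nonempty := by
  obtain ⟨H', hd, hw, hw'⟩ := hH.exists_dual
  rw [hd.polarBody_eq] at h₀ ⊢
  obtain ⟨W, V, t, s, hf, hW, hV, ht, hs, htn, hsn, hts, hss, hmeet⟩ :=
    Billiard.exists_flag_meeting hd hw hw' h₀ hU
  have htraj := hf.isClassicalTrajectory hd hW hV ht htn hts hs hsn hss
  refine ⟨2 * n, _, _, htraj, ?_, ?_, hmeet⟩
  · rw [hf.closedLength_eq hd hW hV ht htn hts]
    refine ⟨⟨2 * n, htraj.two_le, _, htraj.nonTranslatable hd,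
      hf.closedLength_eq hd hW hV ht htn hts⟩, ?_⟩
    rintro _ ⟨m, hm, q, hq, rfl⟩
    exact hd.four_le_closedLength (by omega) hq
  · intro m' q' p' h'
    rw [hf.closedLength_eq hd hW hV ht htn hts]
    exact hd.four_le_closedLength (by have := h'.two_le; omega) (h'.nonTranslatable hd)
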